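/- Write $\mathbb{R}_+=[0,\infty)$. A function $M\colon\mathbb{R}_+\to(0,\infty)$ is called *regularly growing* if it is non-decreasing and continuous and there exists $c\in(0,1)$ such that $$M(s)\ge c\,M\Big(s+\frac{c}{M(s)}\Big),\qquad s\ge 0.$$ For a continuous non-decreasing $M\colon\mathbb{R}_+\to(0,\infty)$ put $$\Omega_M=\Big\{\lambda\in\mathbb{C}:\operatorname{Re}\lambda>-\frac{1}{M(|\operatorname{Im}\lambda|)}\Big\}.$$ **Theorem.** Let $M,K\colon\mathbb{R}_+\to(0,\infty)$ be regularly growing functions with $K(s)\ge M(s)$ for all $s\ge0$, and let $$M_K(s)=M(s)\big(\log(1+s)+\log(1+K(s))\big),\qquad s\ge0.$$ Suppose that $M_K(s)=O(e^{\alpha s})$ as $s\to\infty$ for some $\alpha>0$. Then there exist a complex Banach space $X$ and a bounded $C_0$-semigroup $(T(t))_{t\ge0}$ on $X$ with generator $A$ such that, for some $\delta>1$, the region $\Omega_{\delta M}$ is contained in the resolvent set $\rho(A)$ and $$\sup_{\lambda\in\Omega_{\delta M}}\frac{\|R(\lambda,A)\|}{K(|\operatorname{Im}\lambda|)}<\infty,$$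 where $R(\lambda,A)=(\lambda-A)^{-1}$, and moreover $$\limsup_{t\to\infty}\big\|M_K^{-1}(t)\,T(t)A^{-1}\big\|>0.$$ Here $M_K^{-1}\colon[M_K(0),\infty)\to[0,\infty)$ is the inverse of the strictly increasing bijection $M_K\colon[0,\infty)\to[M_K(0),\infty)$, and the limit superior may be $+\infty$. -/

import Mathlib

open Set Filter Topology Asymptotics
open scoped ENNReal

noncomputable section

namespace SemigroupDecay

/-! Functions `ℝ₊ → (0,∞)` are represented by functions `ℝ → ℝ`, of which only the values on
`[0,∞)` are ever used. -/

/-- Regularly growing functions `M : ℝ₊ → (0,∞)`. -/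
structure RegularlyGrowing (M : ℝ → ℝ) : Prop where
  pos : ∀ s, 0 ≤ s → 0 < M s
  monotoneOn : MonotoneOn M (Ici 0)
  continuousOn : ContinuousOn M (Ici 0)
  regular : ∃ c : ℝ, 0 < c ∧ c < 1 ∧ ∀ s, 0 ≤ s → c * M (s + c / M s) ≤ M s

/-- The region `Ω_M = {λ ∈ ℂ : Re λ > -1 / M(|Im λ|)}`. -/
def Omega (M : ℝ → ℝ) : Set ℂ := {z | -1 / M |z.im| < z.re}

/-- `M_K(s) = M(s) (log (1 + s) + log (1 + K(s)))`. -/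
def MK (M K : ℝ → ℝ) (s : ℝ) : ℝ := M s * (Real.log (1 + s) + Real.log (1 + K s))

/-- The inverse `M_K⁻¹ : [M_K(0),∞) → [0,∞)` of `M_K : [0,∞) → [M_K(0),∞)`. -/
def MKinv (M K : ℝ → ℝ) : ℝ → ℝ := Function.invFunOn (MK M K) (Ici 0)

/-- `M_K` is a bijection of `[0,∞)` onto `[M_K(0),∞)`, so that `MKinv` is its inverse there. -/
theorem bijOn_MK {M K : ℝ → ℝ} (hM : RegularlyGrowing M) (hK : RegularlyGrowing K) :
    BijOn (MK M K) (Ici 0) (Ici (MK M K 0)) := by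
  have hlog : StrictMonoOn (fun s => Real.log (1 + s) + Real.log (1 + K s)) (Ici 0) := by
    intro s hs t ht hst
    have hs' : (0 : ℝ) ≤ s := hs
    have h1 : Real.log (1 + s) < Real.log (1 + t) := Real.log_lt_log (by linarith) (by linarith)
    have h2 : Real.log (1 + K s) ≤ Real.log (1 + K t) :=
      Real.log_le_log (by linarith [hK.pos s hs]) (by linarith [hK.monotoneOn hs ht hst.le])
    exact add_lt_add_of_lt_of_le h1 h2
  have hlogpos : ∀ s, 0 ≤ s → 0 < Real.log (1 + s) + Real.log (1 + K s) := fun s hs =>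
    add_pos_of_nonneg_of_pos (Real.log_nonneg (by linarith))
      (Real.log_pos (by linarith [hK.pos s hs]))
  have hmono : StrictMonoOn (MK M K) (Ici 0) := by
    intro s hs t ht hst
    exact mul_lt_mul_of_le_of_lt_of_nonneg_of_pos (hM.monotoneOn hs ht hst.le) (hlog hs ht hst)
      (hlogpos s hs).le (hM.pos t ht)
  have hcont : ContinuousOn (MK M K) (Ici 0) := by
    refine hM.continuousOn.mul (ContinuousOn.add ?_ ?_)
    · exact ContinuousOn.log (by fun_prop) fun s (hs : (0 : ℝ) ≤ s) => by positivity
    · exact ContinuousOn.log (continuousOn_const.add hK.continuousOn)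
        fun s hs => by linarith [hK.pos s hs]
  have hlim : Tendsto (MK M K) atTop atTop := by
    have h1 : Tendsto (fun s : ℝ => M 0 * Real.log (1 + s)) atTop atTop :=
      (Real.tendsto_log_atTop.comp (tendsto_atTop_add_const_left _ 1 tendsto_id)).const_mul_atTop
        (hM.pos 0 le_rfl)
    refine tendsto_atTop_mono' _ ?_ h1
    filter_upwards [eventually_ge_atTop (0 : ℝ)] with s hs
    have h2 : 0 ≤ Real.log (1 + K s) := Real.log_nonneg (by linarith [hK.pos s hs])
    have h3 : 0 ≤ Real.log (1 + s) := Real.log_nonneg (by linarith)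
    exact mul_le_mul (hM.monotoneOn self_mem_Ici hs hs) (by linarith) h3 (hM.pos s hs).le
  refine ⟨fun s hs => hmono.monotoneOn self_mem_Ici hs hs, hmono.injOn, fun t ht => ?_⟩
  obtain ⟨b, hb0, hbt⟩ := ((eventually_ge_atTop (0 : ℝ)).and (hlim.eventually_ge_atTop t)).exists
  obtain ⟨s, hs, rfl⟩ := intermediate_value_Icc hb0 (hcont.mono Icc_subset_Ici_self) ⟨ht, hbt⟩
  exact ⟨s, hs.1, rfl⟩

section Semigroups

variable {X : Type*} [NormedAddCommGroup X] [NormedSpace ℂ X]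

/-- `(T t)_{t ≥ 0}` is a `C₀`-semigroup on `X`; the values `T t` for `t < 0` play no role. -/
structure IsC0Semigroup (T : ℝ → X →L[ℂ] X) : Prop where
  zero : T 0 = ContinuousLinearMap.id ℂ X
  add : ∀ s t, 0 ≤ s → 0 ≤ t → T (s + t) = (T s).comp (T t)
  strong_continuity : ∀ x, Tendsto (fun t => T t x) (𝓝[>] 0) (𝓝 x)

/-- The semigroup is bounded: `sup_{t ≥ 0} ‖T t‖ < ∞`. -/
def IsBoundedSemigroup (T : ℝ → X →L[ℂ] X) : Prop := ∃ C : ℝ, ∀ t, 0 ≤ t → ‖T t‖ ≤ C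

/-- `A x = y` for the generator `A` of `T`: `(T h x - x) / h → y` as `h → 0+`. -/
def GeneratorAt (T : ℝ → X →L[ℂ] X) (x y : X) : Prop :=
  Tendsto (fun h : ℝ => ((h⁻¹ : ℝ) : ℂ) • (T h x - x)) (𝓝[>] 0) (𝓝 y)

theorem GeneratorAt.add {T : ℝ → X →L[ℂ] X} {x y x' y' : X} (h : GeneratorAt T x y)
    (h' : GeneratorAt T x' y') : GeneratorAt T (x + x') (y + y') := by
  refine (Tendsto.add h h').congr fun s => ?_
  rw [map_add, ← smul_add]
  congr 1
  abel

theorem GeneratorAt.smul {T : ℝ → X →L[ℂ] X} {x y : X} (a : ℂ) (h : GeneratorAt T x y) :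
    GeneratorAt T (a • x) (a • y) := by
  refine (Tendsto.const_smul h a).congr fun s => ?_
  rw [map_smul, ← smul_sub, smul_comm]

theorem GeneratorAt.unique {T : ℝ → X →L[ℂ] X} {x y y' : X} (h : GeneratorAt T x y)
    (h' : GeneratorAt T x y') : y = y' := tendsto_nhds_unique h h'

/-- The generator of `T`, an unbounded operator whose domain consists of all `x` for which
`lim_{h → 0+} (T h x - x) / h` exists, the limit being its value at `x`. -/
def generator (T : ℝ → X →L[ℂ] X) : X →ₗ.[ℂ] X where
  domain :=
    { carrier := {x | ∃ y, GeneratorAt T x y}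
      add_mem' := fun ⟨_, h⟩ ⟨_, h'⟩ => ⟨_, h.add h'⟩
      zero_mem' := ⟨0, by simp [GeneratorAt]⟩
      smul_mem' := fun a _ ⟨_, h⟩ => ⟨_, h.smul a⟩ }
  toFun :=
    { toFun := fun x => x.2.choose
      map_add' := fun x x' =>
        (x + x').2.choose_spec.unique (x.2.choose_spec.add x'.2.choose_spec)
      map_smul' := fun a x => (a • x).2.choose_spec.unique (x.2.choose_spec.smul a) }

theorem generator_spec (T : ℝ → X →L[ℂ] X) (x : (generator T).domain) :
    GeneratorAt T x (generator T x) := x.2.choose_spec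

/-- `B` is a bounded (everywhere defined) two-sided inverse of the unbounded operator `A`. -/
def IsBoundedInverse (A : X →ₗ.[ℂ] X) (B : X →L[ℂ] X) : Prop :=
  (∀ y, ∃ h : B y ∈ A.domain, A ⟨B y, h⟩ = y) ∧ ∀ x : A.domain, B (A x) = x

theorem IsBoundedInverse.unique {A : X →ₗ.[ℂ] X} {B B' : X →L[ℂ] X}
    (h : IsBoundedInverse A B) (h' : IsBoundedInverse A B') : B = B' := by
  ext y
  obtain ⟨hy, e⟩ := h.1 y
  have := h'.2 ⟨B y, hy⟩
  rw [e] at this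
  exact this.symm

open Classical in
/-- The bounded inverse `A⁻¹` of an unbounded operator `A`, where it exists (otherwise `0`). -/
def inverse (A : X →ₗ.[ℂ] X) : X →L[ℂ] X :=
  if h : ∃ B, IsBoundedInverse A B then h.choose else 0

theorem IsBoundedInverse.inverse_eq {A : X →ₗ.[ℂ] X} {B : X →L[ℂ] X}
    (h : IsBoundedInverse A B) : inverse A = B := by
  have h' : ∃ B, IsBoundedInverse A B := ⟨B, h⟩
  rw [inverse, dif_pos h']
  exact h'.choose_spec.unique h

/-- The operator `z - A`, with the same domain as `A`. -/
def shift (A : X →ₗ.[ℂ] X) (z : ℂ) : X →ₗ.[ℂ] X where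
  domain := A.domain
  toFun := z • A.domain.subtype - A.toFun

/-- The resolvent set `ρ(A)`: all `z` for which `z - A` has a bounded inverse. -/
def resolventSet (A : X →ₗ.[ℂ] X) : Set ℂ := {z | ∃ B, IsBoundedInverse (shift A z) B}

/-- The resolvent `R(z, A) = (z - A)⁻¹`, for `z ∈ ρ(A)`. -/
def resolvent (A : X →ₗ.[ℂ] X) (z : ℂ) : X →L[ℂ] X := inverse (shift A z)

end Semigroups

end SemigroupDecay

end

noncomputable section

namespace SemigroupDecay

open scoped NNReal BoundedContinuousFunction

/-! A scalar signal f is followed through its states (f(s), u_s), where u_s is the Laplace transform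
of f(s + ·), continued analytically to U = Ω_{δ₀M} and of size O(K(|Im z|)) there. Since u' = z u -
f along a trajectory, the resolvent of translation has to act on states by R(a)(c, h) = (h(a), (h(a)
- h)/(· - a)). Let H be the space of such pairs, and X the space of bounded uniformly continuous
H-valued g satisfying g' = z g - R(z)⁻¹ g, with R(z) applied and integrated in time so that no
inverse occurs. Translation is a contraction semigroup on X, and its resolvent is R(z) applied
pointwise (`isBoundedInverse_pointwise`). The resolvent estimate is thus a bound for difference
quotients, which follows from regular growth and the maximum principle (`norm_dslope_le`); the loss
of a disc around a forces a δ larger than δ₀.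

The generator has inverse -R(0), and the first component of R(0) g(s) is the integral of f over [s,
∞). So it suffices to find trajectories of uniformly bounded norm for which this is at least c/r at
some time beyond t = M_K(r), for arbitrarily large r. With L = log((1+r)(1+K(r))), σ = 1/(βr) and ω
= r + (log L)/β, take f(s) = σ e^{iω(s-t)} Γ(σ + i(t-s)/β). Mellin inversion gives the two-sided
transform 2πβσ e^{-zt} e^{σw} exp(-e^w), with w = β(ω + iz) (`twoSided_pulse`).

The dangerous factor is e^{-zt} in the left half plane, t being M(r)L. If M(s) ≥ M(r) e^{-β(r-s)} on
[0, r], then for Im z ≤ r it is at most exp((L/δ₀) e^{β(r - Im z)}), and exp(-e^w) beats this. For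
Im z ≥ r it is at most e^L = (1+r)(1+K(r)), where βσ = 1/r absorbs 1+r and K(r) ≤ K(|Im z|). The
exponential growth bound on M_K supplies arbitrarily large r of this kind
(`exists_large_exp_lower_bound`). Finally, f is close to 1 for a time of order 1/r after t, so its
tail integral is of order at least 1/r at one end of that interval. -/

theorem generator_eq {X : Type*} [NormedAddCommGroup X] [NormedSpace ℂ X] {T : ℝ → X →L[ℂ] X}
    {x y : X} (h : GeneratorAt T x y) : ∃ hx : x ∈ (generator T).domain, generator T ⟨x, hx⟩ = y :=
  ⟨⟨y, h⟩, (generator_spec T ⟨x, ⟨y, h⟩⟩).unique h⟩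

/-! ### Translation semigroups on spaces of bounded mild solutions -/

section MildSolutions

variable {H : Type*} [NormedAddCommGroup H] [NormedSpace ℂ H]

/-- The bounded uniformly continuous `g : ℝ₊ → H` which solve `g' = z g - R(z)⁻¹ g` in the mild
sense for all `z ∈ Λ`. -/
def mildSolutions (Λ : Set ℂ) (R : ℂ → H →L[ℂ] H) : Submodule ℂ (ℝ≥0 →ᵇ H) where
  carrier := {g | UniformContinuous g ∧ ∀ z ∈ Λ, ∀ s h : ℝ≥0, R z (g (s + h) - g s) =
    ∫ r in (0 : ℝ)..h, (z • R z (g (s + r.toNNReal)) - g (s + r.toNNReal))}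
  add_mem' := by
    rintro f g ⟨hf, hf'⟩ ⟨hg, hg'⟩
    refine ⟨hf.add hg, fun z hz s h => ?_⟩
    have e : (f + g) (s + h) - (f + g) s = (f (s + h) - f s) + (g (s + h) - g s) := by
      simp only [BoundedContinuousFunction.coe_add, Pi.add_apply]; abel
    rw [e, map_add, hf' z hz, hg' z hz, ← intervalIntegral.integral_add]
    · refine intervalIntegral.integral_congr fun r _ => ?_
      simp only [BoundedContinuousFunction.coe_add, Pi.add_apply, map_add, smul_add]; abel
    · exact Continuous.intervalIntegrable (by fun_prop) _ _
    · exact Continuous.intervalIntegrable (by fun_prop) _ _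
  zero_mem' := ⟨uniformContinuous_const, by simp⟩
  smul_mem' := by
    rintro a g ⟨hg, hg'⟩
    refine ⟨hg.const_smul a, fun z hz s h => ?_⟩
    have e : (a • g) (s + h) - (a • g) s = a • (g (s + h) - g s) := by
      simp [smul_sub]
    rw [e, map_smul, hg' z hz, ← intervalIntegral.integral_smul]
    refine intervalIntegral.integral_congr fun r _ => ?_
    simp only [BoundedContinuousFunction.coe_smul, map_smul, smul_sub]
    rw [smul_comm]

variable {Λ : Set ℂ} {R : ℂ → H →L[ℂ] H}

theorem isClosed_mildSolutions : IsClosed (mildSolutions Λ R : Set (ℝ≥0 →ᵇ H)) := by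
  have h1 : IsClosed {g : ℝ≥0 →ᵇ H | UniformContinuous g} := by
    refine isClosed_iff_clusterPt.2 fun g hg => ?_
    have hne : (𝓝 g ⊓ 𝓟 {g : ℝ≥0 →ᵇ H | UniformContinuous g}).NeBot := hg
    have hu : TendstoUniformly (fun (f : ℝ≥0 →ᵇ H) => (f : ℝ≥0 → H)) g
        (𝓝 g ⊓ 𝓟 {g : ℝ≥0 →ᵇ H | UniformContinuous g}) :=
      BoundedContinuousFunction.tendsto_iff_tendstoUniformly.1 (tendsto_id.mono_left inf_le_left)
    exact hu.uniformContinuous (Eventually.frequently (mem_inf_of_right (mem_principal_self _)))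
  have h2 : ∀ z, ∀ s h : ℝ≥0, IsClosed {g : ℝ≥0 →ᵇ H | R z (g (s + h) - g s) =
      ∫ r in (0 : ℝ)..h, (z • R z (g (s + r.toNNReal)) - g (s + r.toNNReal))} := by
    intro z s h
    refine isClosed_eq ?_ ?_
    · exact (R z).continuous.comp ((continuous_eval_const _).sub (continuous_eval_const _))
    · refine intervalIntegral.continuous_parametric_intervalIntegral_of_continuous' ?_ _ _
      have h3 : Continuous fun p : (ℝ≥0 →ᵇ H) × ℝ => p.1 (s + p.2.toNNReal) :=
        continuous_fst.eval (by fun_prop)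
      exact ((((R z).continuous.comp h3).const_smul z).sub h3)
  have h3 : (mildSolutions Λ R : Set (ℝ≥0 →ᵇ H)) = {g : ℝ≥0 →ᵇ H | UniformContinuous g} ∩
      ⋂ z ∈ Λ, ⋂ s : ℝ≥0, ⋂ h : ℝ≥0, {g : ℝ≥0 →ᵇ H | R z (g (s + h) - g s) =
      ∫ r in (0 : ℝ)..h, (z • R z (g (s + r.toNNReal)) - g (s + r.toNNReal))} := by
    ext g
    simp [mildSolutions]
  rw [h3]
  exact h1.inter (isClosed_biInter fun z _ => isClosed_iInter fun s => isClosed_iInter fun h =>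
    h2 z s h)

instance [CompleteSpace H] : CompleteSpace (mildSolutions Λ R) :=
  isClosed_mildSolutions.completeSpace_coe

theorem uniformContinuous_add_const (a : ℝ≥0) : UniformContinuous fun s : ℝ≥0 => s + a :=
  LipschitzWith.uniformContinuous (K := 1) <| LipschitzWith.of_dist_le_mul fun s t => by
    simp [NNReal.dist_eq]

/-- The translation semigroup on mild solutions. -/
def translation (Λ : Set ℂ) (R : ℂ → H →L[ℂ] H) (t : ℝ) :
    mildSolutions Λ R →L[ℂ] mildSolutions Λ R :=
  LinearMap.mkContinuous
    { toFun := fun g => ⟨(g : ℝ≥0 →ᵇ H).compContinuous ⟨fun s => s + t.toNNReal, by fun_prop⟩,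
        g.2.1.comp (uniformContinuous_add_const _), fun z hz s h => by
          have := g.2.2 z hz (s + t.toNNReal) h
          simp only [BoundedContinuousFunction.compContinuous_apply, ContinuousMap.coe_mk]
          rw [add_right_comm s h, this]
          refine intervalIntegral.integral_congr fun r _ => ?_
          simp only [add_right_comm s r.toNNReal]⟩
      map_add' := fun _ _ => rfl
      map_smul' := fun _ _ => rfl } 1 fun g => by
    rw [one_mul]
    exact (BoundedContinuousFunction.norm_le (norm_nonneg _)).2 fun s =>
      (g : ℝ≥0 →ᵇ H).norm_coe_le_norm _

@[simp] theorem translation_apply (t : ℝ) (g : mildSolutions Λ R) (s : ℝ≥0) :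
    (translation Λ R t g : ℝ≥0 →ᵇ H) s = (g : ℝ≥0 →ᵇ H) (s + t.toNNReal) := rfl

theorem mildSolutions_ext {f g : mildSolutions Λ R}
    (h : ∀ s, (f : ℝ≥0 →ᵇ H) s = (g : ℝ≥0 →ᵇ H) s) : f = g :=
  Subtype.ext (BoundedContinuousFunction.ext h)

theorem mildSolutions_norm_le {f : mildSolutions Λ R} {C : ℝ} (hC : 0 ≤ C)
    (h : ∀ s, ‖(f : ℝ≥0 →ᵇ H) s‖ ≤ C) : ‖f‖ ≤ C :=
  (BoundedContinuousFunction.norm_le hC).2 h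

theorem mildSolutions_norm_apply_le (f : mildSolutions Λ R) (s : ℝ≥0) :
    ‖(f : ℝ≥0 →ᵇ H) s‖ ≤ ‖f‖ := (f : ℝ≥0 →ᵇ H).norm_coe_le_norm s

/-- For a uniformly continuous function, all small translates are uniformly close. -/
theorem mildSolutions_eventually_translate (g : mildSolutions Λ R) {ε : ℝ} (hε : 0 < ε) :
    ∀ᶠ h in 𝓝[>] (0 : ℝ), ∀ r ∈ Icc 0 h, ∀ s,
      ‖(g : ℝ≥0 →ᵇ H) (s + r.toNNReal) - (g : ℝ≥0 →ᵇ H) s‖ ≤ ε := by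
  obtain ⟨d, hd, hg⟩ := Metric.uniformContinuous_iff.1 g.2.1 ε hε
  filter_upwards [Ioo_mem_nhdsGT hd] with h hh r hr s
  rw [← dist_eq_norm]
  refine (hg ?_).le
  rw [NNReal.dist_eq, NNReal.coe_add, Real.coe_toNNReal _ hr.1, add_sub_cancel_left,
    abs_of_nonneg hr.1]
  exact hr.2.trans_lt hh.2

theorem isC0Semigroup_translation : IsC0Semigroup (translation Λ R) where
  zero := by
    ext1 g
    exact mildSolutions_ext fun s => by simp
  add s t hs ht := by
    ext1 g
    refine mildSolutions_ext fun r => ?_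
    simp [Real.toNNReal_add hs ht, add_assoc]
  strong_continuity g := by
    refine Metric.tendsto_nhds.2 fun ε hε => ?_
    filter_upwards [mildSolutions_eventually_translate g (half_pos hε), self_mem_nhdsWithin] with h hh h0
    rw [dist_eq_norm]
    refine (mildSolutions_norm_le (half_pos hε).le fun s => ?_).trans_lt (half_lt_self hε)
    exact hh h ⟨le_of_lt h0, le_rfl⟩ s

theorem isBoundedSemigroup_translation : IsBoundedSemigroup (translation Λ R) :=
  ⟨1, fun _ _ => LinearMap.mkContinuous_norm_le _ zero_le_one _⟩

variable [CompleteSpace H]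

/-- An operator which commutes with all `R z` acts pointwise on mild solutions. -/
def pointwise (B : H →L[ℂ] H) (hB : ∀ z ∈ Λ, ∀ x, B (R z x) = R z (B x)) :
    mildSolutions Λ R →L[ℂ] mildSolutions Λ R :=
  LinearMap.mkContinuous
    { toFun := fun g => ⟨BoundedContinuousFunction.ofNormedAddCommGroup
        (fun s => B ((g : ℝ≥0 →ᵇ H) s)) (by fun_prop) (‖B‖ * ‖g‖)
        fun s => (B.le_opNorm _).trans (by gcongr; exact mildSolutions_norm_apply_le g s),
        B.uniformContinuous.comp g.2.1, fun z hz s h => by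
          simp only [BoundedContinuousFunction.coe_ofNormedAddCommGroup]
          rw [← map_sub, ← hB z hz, g.2.2 z hz, ← B.intervalIntegral_comp_comm]
          · simp only [map_sub, map_smul, hB z hz]
          · exact Continuous.intervalIntegrable (by fun_prop) _ _⟩
      map_add' := fun f g => mildSolutions_ext fun s => by simp
      map_smul' := fun a g => mildSolutions_ext fun s => by simp } ‖B‖ fun g =>
    mildSolutions_norm_le (by positivity) fun s => (B.le_opNorm _).trans
      (by gcongr; exact mildSolutions_norm_apply_le g s)

@[simp] theorem pointwise_apply (B : H →L[ℂ] H) (hB : ∀ z ∈ Λ, ∀ x, B (R z x) = R z (B x))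
    (g : mildSolutions Λ R) (s : ℝ≥0) :
    (pointwise B hB g : ℝ≥0 →ᵇ H) s = B ((g : ℝ≥0 →ᵇ H) s) := rfl

theorem norm_pointwise_le (B : H →L[ℂ] H) (hB : ∀ z ∈ Λ, ∀ x, B (R z x) = R z (B x)) :
    ‖pointwise B hB‖ ≤ ‖B‖ := LinearMap.mkContinuous_norm_le _ (norm_nonneg _) _

theorem pointwise_translation (B : H →L[ℂ] H) (hB : ∀ z ∈ Λ, ∀ x, B (R z x) = R z (B x))
    (t : ℝ) (g : mildSolutions Λ R) :
    pointwise B hB (translation Λ R t g) = translation Λ R t (pointwise B hB g) := rfl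

/-- The integrated equation says that the increment of R(z)g over [s, s+h] is the integral of v = z
R(z)g - g. Uniform continuity of v makes the averages of v converge uniformly in s, which is
convergence in the norm of the space. -/
theorem generatorAt_pointwise {z : ℂ} (hz : z ∈ Λ)
    (hR : ∀ w ∈ Λ, ∀ x, R z (R w x) = R w (R z x)) (g : mildSolutions Λ R) :
    GeneratorAt (translation Λ R) (pointwise (R z) hR g) (z • pointwise (R z) hR g - g) := by
  set v : mildSolutions Λ R := z • pointwise (R z) hR g - g with hv
  refine Metric.tendsto_nhds.2 fun ε hε => ?_
  filter_upwards [mildSolutions_eventually_translate v (half_pos hε), self_mem_nhdsWithin] with h hh h0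
  have h0' : (0 : ℝ) < h := h0
  rw [dist_eq_norm]
  refine (mildSolutions_norm_le (half_pos hε).le fun s => ?_).trans_lt (half_lt_self hε)
  have e1 : (((translation Λ R h (pointwise (R z) hR g) - pointwise (R z) hR g :
      mildSolutions Λ R)) : ℝ≥0 →ᵇ H) s =
      ∫ r in (0 : ℝ)..h, (v : ℝ≥0 →ᵇ H) (s + r.toNNReal) := by
    have := g.2.2 z hz s h.toNNReal
    rw [Real.coe_toNNReal _ h0'.le] at this
    rw [hv]
    simpa using this
  have e2 : (∫ _ in (0 : ℝ)..h, (v : ℝ≥0 →ᵇ H) s) = (h : ℂ) • (v : ℝ≥0 →ᵇ H) s := by simp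
  have hi : ∀ a b, IntervalIntegrable (fun r : ℝ => (v : ℝ≥0 →ᵇ H) (s + r.toNNReal))
      MeasureTheory.volume a b := fun a b => Continuous.intervalIntegrable (by fun_prop) _ _
  have e3 : (((((h⁻¹ : ℝ) : ℂ) • (translation Λ R h (pointwise (R z) hR g) -
      pointwise (R z) hR g) - v : mildSolutions Λ R)) : ℝ≥0 →ᵇ H) s =
      ((h⁻¹ : ℝ) : ℂ) • ∫ r in (0 : ℝ)..h,
        ((v : ℝ≥0 →ᵇ H) (s + r.toNNReal) - (v : ℝ≥0 →ᵇ H) s) := by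
    have e5 : ((h⁻¹ : ℝ) : ℂ) • (h : ℂ) • (v : ℝ≥0 →ᵇ H) s = (v : ℝ≥0 →ᵇ H) s := by
      rw [smul_smul, ← Complex.ofReal_mul, inv_mul_cancel₀ h0'.ne', Complex.ofReal_one, one_smul]
    rw [intervalIntegral.integral_sub (hi _ _) intervalIntegrable_const, ← e1, e2]
    conv_rhs => rw [smul_sub, e5]
    rfl
  rw [e3, norm_smul, Complex.norm_real, Real.norm_of_nonneg (inv_nonneg.2 h0'.le)]
  have e4 := intervalIntegral.norm_integral_le_of_norm_le_const (a := 0) (b := h) (C := ε / 2)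
    (f := fun r : ℝ => (v : ℝ≥0 →ᵇ H) (s + r.toNNReal) - (v : ℝ≥0 →ᵇ H) s) fun r hr => by
      rw [uIoc_of_le h0'.le] at hr
      exact hh r ⟨hr.1.le, hr.2⟩ s
  rw [sub_zero, abs_of_pos h0'] at e4
  calc h⁻¹ * _ ≤ h⁻¹ * (ε / 2 * h) := by gcongr
    _ = ε / 2 := by field_simp

/-- R(z) need not be injective on H; in the application it kills every (c, 0). The left inverse
property comes instead from R(z) commuting with translations: the generator applied to R(z)g is both
R(z)Ag and z R(z)g - g. -/
theorem isBoundedInverse_pointwise {z : ℂ} (hz : z ∈ Λ)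
    (hR : ∀ w ∈ Λ, ∀ x, R z (R w x) = R w (R z x)) :
    IsBoundedInverse (shift (generator (translation Λ R)) z) (pointwise (R z) hR) := by
  refine ⟨fun g => ?_, fun g => ?_⟩
  · obtain ⟨hx, e⟩ := generator_eq (generatorAt_pointwise hz hR g)
    refine ⟨hx, ?_⟩
    change z • pointwise (R z) hR g - generator (translation Λ R) ⟨_, hx⟩ = g
    rw [e, sub_sub_cancel]
  · change pointwise (R z) hR (z • (g : mildSolutions Λ R) - generator (translation Λ R) g) = g
    have h1 := generator_spec (translation Λ R) g
    have h2 : GeneratorAt (translation Λ R) (pointwise (R z) hR g)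
        (pointwise (R z) hR (generator (translation Λ R) g)) := by
      refine (((pointwise (R z) hR).continuous.tendsto _).comp h1).congr fun h => ?_
      simp only [Function.comp, map_smul, map_sub, pointwise_translation]
    rw [map_sub, map_smul, h2.unique (generatorAt_pointwise hz hR g), sub_sub_cancel]

end MildSolutions

theorem IsBoundedInverse.neg_of_shift_zero {X : Type*} [NormedAddCommGroup X] [NormedSpace ℂ X]
    {A : X →ₗ.[ℂ] X} {B : X →L[ℂ] X} (h : IsBoundedInverse (shift A 0) B) :
    IsBoundedInverse A (-B) := by
  have e : ∀ x : A.domain, shift A 0 x = -A x := fun x => by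
    change (0 : ℂ) • (x : X) - A x = -A x
    rw [zero_smul, zero_sub]
  refine ⟨fun y => ?_, fun x => ?_⟩
  · obtain ⟨hy, hy'⟩ := h.1 y
    refine ⟨A.domain.neg_mem hy, ?_⟩
    change A (-(⟨B y, hy⟩ : A.domain)) = y
    rw [LinearPMap.map_neg, ← e]
    exact hy'
  · have := h.2 x
    rw [e, map_neg] at this
    exact this

end SemigroupDecay

namespace SemigroupDecay

open scoped NNReal BoundedContinuousFunction

/-! ### Weighted spaces of analytic functions and their difference quotients -/

section Weighted

open Classical in
/-- The function on `U` represented by the bounded function `φ` with respect to the weight `k`,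
extended by zero. -/
def unweight (U : Set ℂ) (k : ℂ → ℝ) (φ : U →ᵇ ℂ) (z : ℂ) : ℂ :=
  if hz : z ∈ U then k z * φ ⟨z, hz⟩ else 0

variable {U : Set ℂ} {k : ℂ → ℝ}

theorem unweight_add (φ ψ : U →ᵇ ℂ) :
    unweight U k (φ + ψ) = unweight U k φ + unweight U k ψ := by
  ext z
  by_cases hz : z ∈ U <;> simp [unweight, hz, mul_add]

theorem unweight_smul (a : ℂ) (φ : U →ᵇ ℂ) :
    unweight U k (a • φ) = a • unweight U k φ := by
  ext z
  by_cases hz : z ∈ U <;> simp [unweight, hz, mul_left_comm]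

/-- The analytic functions `h` on `U` with `h = O(k)`, represented by the bounded functions
`h / k`. -/
def weightedAnalytic (U : Set ℂ) (k : ℂ → ℝ) : Submodule ℂ (U →ᵇ ℂ) where
  carrier := {φ | DifferentiableOn ℂ (unweight U k φ) U}
  add_mem' := fun {φ ψ} hφ hψ => by
    rw [mem_ofPred_eq, unweight_add]
    exact hφ.add hψ
  zero_mem' := by
    have : unweight U k 0 = 0 := by
      ext z
      by_cases hz : z ∈ U <;> simp [unweight, hz]
    rw [mem_ofPred_eq, this]
    exact differentiableOn_const 0
  smul_mem' := fun a φ hφ => by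
    rw [mem_ofPred_eq, unweight_smul]
    exact hφ.const_smul a

/-- The weight is locally bounded, so uniform convergence of h / k gives locally uniform convergence
of h, and Weierstrass' theorem applies. -/
theorem isClosed_weightedAnalytic (hU : IsOpen U) (hk : ContinuousOn k U) :
    IsClosed (weightedAnalytic U k : Set (U →ᵇ ℂ)) := by
  refine isClosed_iff_clusterPt.2 fun φ hφ => ?_
  have hne : (𝓝 φ ⊓ 𝓟 (weightedAnalytic U k : Set (U →ᵇ ℂ))).NeBot := hφ
  have hlim' : TendstoLocallyUniformlyOn (fun ψ : U →ᵇ ℂ => unweight U k ψ) (unweight U k φ)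
      (𝓝 φ) U := by
    refine Metric.tendstoLocallyUniformlyOn_iff.2 fun ε hε z hz => ?_
    have h1 : {w | ‖k w‖ < ‖k z‖ + 1} ∈ 𝓝[U] z :=
      (hk z hz).norm.eventually_lt_const (lt_add_one _)
    refine ⟨_, inter_mem h1 self_mem_nhdsWithin, ?_⟩
    filter_upwards [Metric.ball_mem_nhds φ (show 0 < ε / (‖k z‖ + 1) by positivity)] with ψ hψ
    rintro w ⟨hw, hwU⟩
    rw [Metric.mem_ball, dist_comm] at hψ
    have h2 : dist (φ ⟨w, hwU⟩) (ψ ⟨w, hwU⟩) < ε / (‖k z‖ + 1) :=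
      (BoundedContinuousFunction.dist_coe_le_dist _).trans_lt hψ
    simp only [unweight, hwU, dif_pos]
    rw [dist_eq_norm, ← mul_sub, norm_mul, ← dist_eq_norm, Complex.norm_real]
    have hw' : ‖k w‖ < ‖k z‖ + 1 := hw
    calc ‖k w‖ * dist (φ ⟨w, hwU⟩) (ψ ⟨w, hwU⟩)
        ≤ (‖k z‖ + 1) * dist (φ ⟨w, hwU⟩) (ψ ⟨w, hwU⟩) := by gcongr
      _ < (‖k z‖ + 1) * (ε / (‖k z‖ + 1)) := by gcongr
      _ = ε := by field_simp
  have hlim : TendstoLocallyUniformlyOn (fun ψ : U →ᵇ ℂ => unweight U k ψ) (unweight U k φ)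
      (𝓝 φ ⊓ 𝓟 (weightedAnalytic U k : Set (U →ᵇ ℂ))) U := fun u hu z hz =>
    (hlim' u hu z hz).imp fun t ht => ⟨ht.1, ht.2.filter_mono inf_le_left⟩
  exact hlim.differentiableOn (Filter.mem_inf_of_right (mem_principal_self _)) hU

/-- Evaluation at a point, as a bounded functional. -/
def evalAt (U : Set ℂ) (k : ℂ → ℝ) (z : ℂ) : weightedAnalytic U k →L[ℂ] ℂ :=
  LinearMap.mkContinuous
    { toFun := fun φ => unweight U k φ z
      map_add' := fun φ ψ => by
        rw [Submodule.coe_add, unweight_add]; rfl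
      map_smul' := fun a φ => by
        rw [Submodule.coe_smul, unweight_smul]; rfl } |k z| fun φ => by
    by_cases hz : z ∈ U
    · simp only [LinearMap.coe_mk, AddHom.coe_mk, unweight, hz, dif_pos, norm_mul,
        Complex.norm_real, Real.norm_eq_abs]
      gcongr
      exact (φ : U →ᵇ ℂ).norm_coe_le_norm _
    · simp only [LinearMap.coe_mk, AddHom.coe_mk, unweight, hz, dif_neg, not_false_eq_true,
        norm_zero]
      positivity

theorem evalAt_apply (z : ℂ) (φ : weightedAnalytic U k) : evalAt U k z φ = unweight U k φ z := rfl

theorem norm_evalAt_le (z : ℂ) : ‖evalAt U k z‖ ≤ |k z| :=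
  LinearMap.mkContinuous_norm_le _ (abs_nonneg _) _

theorem differentiableOn_evalAt (φ : weightedAnalytic U k) :
    DifferentiableOn ℂ (fun z => evalAt U k z φ) U := φ.2

theorem norm_evalAt_apply_le (hk : ∀ z ∈ U, 0 < k z) {z : ℂ} (hz : z ∈ U)
    (φ : weightedAnalytic U k) : ‖evalAt U k z φ‖ ≤ ‖φ‖ * k z := by
  refine ((evalAt U k z).le_opNorm φ).trans ?_
  rw [mul_comm]
  gcongr
  exact (norm_evalAt_le z).trans_eq (abs_of_pos (hk z hz))

/-- An analytic function bounded by a multiple of the weight, as an element of the space. -/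
theorem exists_weightedAnalytic (hk : ContinuousOn k U) (hk0 : ∀ z ∈ U, 0 < k z) {h : ℂ → ℂ}
    (hh : DifferentiableOn ℂ h U) {C : ℝ} (hC : 0 ≤ C) (hb : ∀ z ∈ U, ‖h z‖ ≤ C * k z) :
    ∃ φ : weightedAnalytic U k, (∀ z ∈ U, evalAt U k z φ = h z) ∧ ‖φ‖ ≤ C := by
  have hb' : ∀ z : U, ‖h z / (k z : ℂ)‖ ≤ C := fun z => by
    rw [norm_div, Complex.norm_real, Real.norm_of_nonneg (hk0 z z.2).le, div_le_iff₀ (hk0 z z.2)]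
    exact hb z z.2
  have hcont : Continuous fun z : U => h z / (k z : ℂ) := by
    refine (continuousOn_iff_continuous_domRestrict.1 hh.continuousOn).div
      (Complex.continuous_ofReal.comp (continuousOn_iff_continuous_domRestrict.1 hk)) fun z => ?_
    exact Complex.ofReal_ne_zero.2 (hk0 z z.2).ne'
  set φ := BoundedContinuousFunction.ofNormedAddCommGroup _ hcont C hb' with hφ
  have e : ∀ z ∈ U, unweight U k φ z = h z := fun z hz => by
    simp only [unweight, hz, dif_pos, hφ, BoundedContinuousFunction.coe_ofNormedAddCommGroup]
    exact mul_div_cancel₀ _ (Complex.ofReal_ne_zero.2 (hk0 z hz).ne')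
  exact ⟨⟨φ, hh.congr e⟩, e, (BoundedContinuousFunction.norm_le hC).2 hb'⟩

/-- Two elements of the space agree if they agree off a finite set. -/
theorem weightedAnalytic_ext (hU : IsOpen U) (hk0 : ∀ z ∈ U, 0 < k z) {φ ψ : weightedAnalytic U k}
    (s : Set ℂ) (hs : s.Finite) (h : ∀ z ∈ U, z ∉ s → evalAt U k z φ = evalAt U k z ψ) :
    φ = ψ := by
  have h1 : ∀ z ∈ U, evalAt U k z φ = evalAt U k z ψ := fun z hz => by
    have hφ := ((differentiableOn_evalAt φ).differentiableAt (hU.mem_nhds hz)).continuousAt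
    have hψ := ((differentiableOn_evalAt ψ).differentiableAt (hU.mem_nhds hz)).continuousAt
    refine ((hφ.eventuallyEq_nhds_iff_eventuallyEq_nhdsNE hψ).1 ?_).eq_of_nhds
    have h2 : ∀ᶠ w in 𝓝[≠] z, w ∉ s := by
      have : (s \ {z})ᶜ ∈ 𝓝 z := (hs.subset sdiff_subset).isClosed.isOpen_compl.mem_nhds (by simp)
      filter_upwards [mem_nhdsWithin_of_mem_nhds this, self_mem_nhdsWithin] with w hw hw' hws
      exact hw ⟨hws, hw'⟩
    filter_upwards [h2, mem_nhdsWithin_of_mem_nhds (hU.mem_nhds hz)] with w hw hwU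
    exact h w hwU hw
  refine Subtype.ext (BoundedContinuousFunction.ext fun z => ?_)
  have h2 := h1 z z.2
  simp only [evalAt_apply, unweight, z.2, dif_pos] at h2
  exact mul_left_cancel₀ (Complex.ofReal_ne_zero.2 (hk0 z z.2).ne') h2

/-- If the weight `k` varies slowly at scale `1 / k`, then difference quotients of functions
bounded by `k` are bounded by a multiple of `k(z) k(w)`. -/
theorem norm_dslope_le (hU : IsOpen U) (hk0 : ∀ z ∈ U, 0 < k z) {c : ℝ} (hc0 : 0 < c) (hc1 : c ≤ 1)
    (hreg : ∀ z ∈ U, ∀ w ∈ U, ‖z - w‖ ≤ c / k w → c * k z ≤ k w)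
    {a : ℂ} (ha : a ∈ U) (hball : Metric.closedBall a (c / k a) ⊆ U)
    {h : ℂ → ℂ} (hh : DifferentiableOn ℂ h U) {N : ℝ} (hN : 0 ≤ N)
    (hb : ∀ z ∈ U, ‖h z‖ ≤ N * k z) {w : ℂ} (hw : w ∈ U) :
    ‖dslope h a w‖ ≤ 2 / c ^ 3 * k a * N * k w := by
  have hka := hk0 a ha
  have hr : 0 < c / k a := by positivity
  have hfar : ∀ z ∈ U, c / k a ≤ ‖z - a‖ →
      ‖dslope h a z‖ ≤ N * (k a + k z) / ‖z - a‖ := fun z hz hza => by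
    have hne : z ≠ a := fun e => by
      rw [e, sub_self, norm_zero] at hza
      linarith
    rw [dslope_of_ne _ hne, slope_def_field, norm_div]
    gcongr
    calc ‖h z - h a‖ ≤ ‖h z‖ + ‖h a‖ := norm_sub_le _ _
      _ ≤ N * k z + N * k a := add_le_add (hb z hz) (hb a ha)
      _ = N * (k a + k z) := by ring
  have hc3 : 2 / c ≤ 2 / c ^ 3 := by
    gcongr
    calc c ^ 3 ≤ c ^ 1 := pow_le_pow_of_le_one hc0.le hc1 (by norm_num)
      _ = c := pow_one c
  have hc2 : 2 / c ^ 2 ≤ 2 / c ^ 3 := by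
    gcongr 2 / ?_
    exact pow_le_pow_of_le_one hc0.le hc1 (by norm_num)
  have hkw := hk0 w hw
  -- Away from a the triangle inequality leaves (k a + k w) / |w - a|, to be bounded by a multiple
  -- of the product k a * k w. If |w - a| ≤ c / k w, then k a is dominated by k w. Otherwise 1 / |w
  -- - a| is bounded by both k a / c and k w / c, and the larger weight is paired with the bound
  -- coming from the smaller one.
  rcases le_or_gt (c / k a) ‖w - a‖ with hwa | hwa
  · have h0 : 0 < ‖w - a‖ := hr.trans_le hwa
    refine (hfar w hw hwa).trans ?_
    have hia : 1 / ‖w - a‖ ≤ k a / c := by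
      rw [div_le_div_iff₀ h0 hc0, one_mul]
      exact (div_le_iff₀' hka).1 hwa
    rw [div_eq_mul_one_div]
    by_cases h2 : ‖a - w‖ ≤ c / k w
    · have h3 := hreg a ha w hw h2
      have h4 : k a ≤ k w / c := by rwa [le_div_iff₀' hc0]
      have h5 : k w ≤ k w / c := by rw [le_div_iff₀ hc0]; nlinarith
      calc N * (k a + k w) * (1 / ‖w - a‖) ≤ N * (k w / c + k w / c) * (k a / c) := by gcongr
        _ = 2 / c ^ 2 * k a * N * k w := by field_simp; ring
        _ ≤ 2 / c ^ 3 * k a * N * k w := by gcongr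
    · rw [not_le, norm_sub_rev] at h2
      have hiw : 1 / ‖w - a‖ ≤ k w / c := by
        rw [div_le_div_iff₀ h0 hc0, one_mul]
        exact (div_le_iff₀' hkw).1 h2.le
      refine le_trans ?_ (show 2 / c * k a * N * k w ≤ 2 / c ^ 3 * k a * N * k w by gcongr)
      rcases le_total (k a) (k w) with h3 | h3
      · calc N * (k a + k w) * (1 / ‖w - a‖) ≤ N * (k w + k w) * (k a / c) := by gcongr
          _ = 2 / c * k a * N * k w := by field_simp; ring
      · calc N * (k a + k w) * (1 / ‖w - a‖) ≤ N * (k a + k a) * (k w / c) := by gcongr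
          _ = 2 / c * k a * N * k w := by field_simp; ring
  · have hka' : k a ≤ k w / c := by
      rw [le_div_iff₀' hc0]
      rcases le_total (k w) (k a) with h3 | h3
      · refine hreg a ha w hw ?_
        rw [norm_sub_rev]
        exact hwa.le.trans (by gcongr)
      · nlinarith
    -- Near a the singularity is removable, and the maximum principle carries over the bound from
    -- the circle of radius c / k a, where the far estimate holds.
    have hdiff : DifferentiableOn ℂ (dslope h a) U :=
      (Complex.differentiableOn_dslope (hU.mem_nhds ha)).2 hh
    have hmax : ‖dslope h a w‖ ≤ 2 * N * k a ^ 2 / c ^ 2 := by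
      refine Complex.norm_le_of_forall_mem_frontier_norm_le (U := Metric.ball a (c / k a))
        Metric.isBounded_ball ?_ (fun z hz => ?_) (subset_closure ?_)
      · refine DifferentiableOn.diffContOnCl ?_
        rw [closure_ball a hr.ne']
        exact hdiff.mono hball
      · rw [frontier_ball a hr.ne', mem_sphere_iff_norm] at hz
        have hzU : z ∈ U := hball (by rw [mem_closedBall_iff_norm, hz])
        have h3 : k z ≤ k a / c := by
          rw [le_div_iff₀' hc0]
          exact hreg z hzU a ha hz.le
        have h4 : k a ≤ k a / c := by rw [le_div_iff₀ hc0]; nlinarith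
        calc ‖dslope h a z‖ ≤ N * (k a + k z) / ‖z - a‖ := hfar z hzU hz.ge
          _ ≤ N * (k a / c + k a / c) / (c / k a) := by rw [hz]; gcongr
          _ = 2 * N * k a ^ 2 / c ^ 2 := by field_simp; ring
      · rwa [Metric.mem_ball, dist_eq_norm]
    calc ‖dslope h a w‖ ≤ 2 * N * k a ^ 2 / c ^ 2 := hmax
      _ = 2 * N * k a / c ^ 2 * k a := by ring
      _ ≤ 2 * N * k a / c ^ 2 * (k w / c) := by gcongr
      _ = 2 / c ^ 3 * k a * N * k w := by field_simp

end Weighted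

end SemigroupDecay

namespace SemigroupDecay

open scoped NNReal BoundedContinuousFunction

/-! ### The commuting family of difference-quotient operators, and its mild solutions -/

section Resolvents

variable {U Λ : Set ℂ} {k : ℂ → ℝ}

/-- The backward difference quotient at `a` is a bounded operator on `weightedAnalytic U k`. -/
theorem exists_differenceQuotient (hU : IsOpen U) (hk : ContinuousOn k U)
    (hk0 : ∀ z ∈ U, 0 < k z) {a : ℂ} (ha : a ∈ U) {C : ℝ} (hC : 0 ≤ C)
    (hD : ∀ (h : ℂ → ℂ) (N : ℝ), DifferentiableOn ℂ h U → 0 ≤ N → (∀ z ∈ U, ‖h z‖ ≤ N * k z) →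
      ∀ w ∈ U, ‖dslope h a w‖ ≤ C * N * k w) :
    ∃ D : weightedAnalytic U k →L[ℂ] weightedAnalytic U k, ‖D‖ ≤ C ∧
      ∀ φ, ∀ w ∈ U, w ≠ a → evalAt U k w (D φ) = (evalAt U k a φ - evalAt U k w φ) / (w - a) := by
  have h1 : ∀ φ : weightedAnalytic U k, ∃ ψ : weightedAnalytic U k,
      (∀ w ∈ U, w ≠ a → evalAt U k w ψ = (evalAt U k a φ - evalAt U k w φ) / (w - a)) ∧
        ‖ψ‖ ≤ C * ‖φ‖ := fun φ => by
    have hd := (Complex.differentiableOn_dslope (hU.mem_nhds ha)).2 (differentiableOn_evalAt φ)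
    obtain ⟨ψ, hψ, hψ'⟩ := exists_weightedAnalytic hk hk0 hd.neg (C := C * ‖φ‖) (by positivity)
      fun w hw => by
        rw [Pi.neg_apply, norm_neg]
        exact hD _ _ (differentiableOn_evalAt φ) (norm_nonneg _)
          (fun z hz => norm_evalAt_apply_le hk0 hz φ) w hw
    refine ⟨ψ, fun w hw hwa => ?_, hψ'⟩
    rw [hψ w hw, Pi.neg_apply, dslope_of_ne _ hwa, slope_def_field, ← neg_div, neg_sub]
  choose D hDe hDn using h1
  -- The values of D φ are recorded only off a, but elements of the space that agree there coincide,
  -- so linearity may be checked off a.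
  refine ⟨LinearMap.mkContinuous
    { toFun := D
      map_add' := fun φ ψ => weightedAnalytic_ext hU hk0 {a} (finite_singleton a)
        fun z hz hza => ?_
      map_smul' := fun b φ => weightedAnalytic_ext hU hk0 {a} (finite_singleton a)
        fun z hz hza => ?_ } C hDn, LinearMap.mkContinuous_norm_le _ hC _, hDe⟩
  · rw [map_add, hDe _ z hz hza, hDe _ z hz hza, hDe _ z hz hza, map_add, map_add]
    ring
  · rw [map_smul, hDe _ z hz hza, hDe _ z hz hza, map_smul, map_smul]
    simp only [RingHom.id_apply, smul_eq_mul]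
    ring

/-- The pseudo-resolvent `(c, h) ↦ (h(a), (h(a) - h) / (· - a))`. -/
theorem exists_resolvents (hU : IsOpen U) (hk : ContinuousOn k U) (hk0 : ∀ z ∈ U, 0 < k z)
    (hΛ : Λ ⊆ U) {C : ℝ} (hC : 1 ≤ C)
    (hD : ∀ a ∈ Λ, ∀ (h : ℂ → ℂ) (N : ℝ), DifferentiableOn ℂ h U → 0 ≤ N →
      (∀ z ∈ U, ‖h z‖ ≤ N * k z) → ∀ w ∈ U, ‖dslope h a w‖ ≤ C * k a * N * k w) :
    ∃ R : ℂ → (ℂ × weightedAnalytic U k →L[ℂ] ℂ × weightedAnalytic U k), ∀ a ∈ Λ,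
      ‖R a‖ ≤ C * k a ∧ (∀ x, (R a x).1 = evalAt U k a x.2) ∧
      ∀ x, ∀ w ∈ U, w ≠ a →
        evalAt U k w (R a x).2 = (evalAt U k a x.2 - evalAt U k w x.2) / (w - a) := by
  have h1 : ∀ a, ∃ R : ℂ × weightedAnalytic U k →L[ℂ] ℂ × weightedAnalytic U k, a ∈ Λ →
      ‖R‖ ≤ C * k a ∧ (∀ x, (R x).1 = evalAt U k a x.2) ∧
      ∀ x, ∀ w ∈ U, w ≠ a →
        evalAt U k w (R x).2 = (evalAt U k a x.2 - evalAt U k w x.2) / (w - a) := fun a => by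
    by_cases ha : a ∈ Λ
    · have hka := hk0 a (hΛ ha)
      obtain ⟨D, hDn, hDe⟩ := exists_differenceQuotient hU hk hk0 (hΛ ha) (C := C * k a)
        (by positivity) (hD a ha)
      refine ⟨((evalAt U k a).prod D).comp (ContinuousLinearMap.snd ℂ _ _), fun _ =>
        ⟨ContinuousLinearMap.opNorm_le_bound _ (by positivity) fun x => ?_, fun x => rfl,
          fun x => hDe x.2⟩⟩
      have hx : ‖x.2‖ ≤ ‖x‖ := norm_snd_le x
      refine max_le ?_ ?_
      · calc ‖evalAt U k a x.2‖ ≤ ‖x.2‖ * k a := norm_evalAt_apply_le hk0 (hΛ ha) _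
          _ ≤ ‖x‖ * (C * k a) := by gcongr; nlinarith
          _ = C * k a * ‖x‖ := mul_comm _ _
      · exact (D.le_of_opNorm_le hDn x.2).trans (by gcongr)
    · exact ⟨0, fun h => absurd h ha⟩
  choose R hR using h1
  exact ⟨R, fun a ha => hR a ha⟩

variable {R : ℂ → (ℂ × weightedAnalytic U k →L[ℂ] ℂ × weightedAnalytic U k)}

/-- The first component of either side is minus the divided difference of h at a, b, and the second
is the divided difference at a, b, z; both are symmetric in a and b. -/
theorem resolvents_commute (hU : IsOpen U) (hk0 : ∀ z ∈ U, 0 < k z) (hΛ : Λ ⊆ U)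
    (hR1 : ∀ a ∈ Λ, ∀ x, (R a x).1 = evalAt U k a x.2)
    (hR2 : ∀ a ∈ Λ, ∀ x, ∀ w ∈ U, w ≠ a →
      evalAt U k w (R a x).2 = (evalAt U k a x.2 - evalAt U k w x.2) / (w - a))
    {a b : ℂ} (ha : a ∈ Λ) (hb : b ∈ Λ) (x : ℂ × weightedAnalytic U k) :
    R a (R b x) = R b (R a x) := by
  rcases eq_or_ne a b with rfl | hab
  · rfl
  refine Prod.ext ?_ (weightedAnalytic_ext hU hk0 {a, b} (by simp) fun z hz hzs => ?_)
  · rw [hR1 a ha, hR1 b hb, hR2 a ha _ b (hΛ hb) hab.symm, hR2 b hb _ a (hΛ ha) hab,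
      ← neg_sub b a, ← neg_sub (evalAt U k a x.2), neg_div_neg_eq]
  · rw [mem_insert_iff, mem_singleton_iff, not_or] at hzs
    have h1 : z - a ≠ 0 := sub_ne_zero.2 hzs.1
    have h2 : z - b ≠ 0 := sub_ne_zero.2 hzs.2
    have h3 : a - b ≠ 0 := sub_ne_zero.2 hab
    have h4 : b - a ≠ 0 := sub_ne_zero.2 hab.symm
    rw [hR2 a ha _ z hz hzs.1, hR2 b hb _ z hz hzs.2, hR2 b hb _ z hz hzs.2,
      hR2 a ha _ z hz hzs.1, hR2 a ha _ b (hΛ hb) hab.symm, hR2 b hb _ a (hΛ ha) hab]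
    rw [← neg_sub b a] at h3 ⊢
    field_simp
    ring

/-- Construction of a mild solution from a bounded function `f` and its Laplace transforms. -/
theorem exists_mildSolution (hU : IsOpen U) (hk : ContinuousOn k U) (hk0 : ∀ z ∈ U, 0 < k z)
    (hΛ : Λ ⊆ U) (hR1 : ∀ a ∈ Λ, ∀ x, (R a x).1 = evalAt U k a x.2)
    (hR2 : ∀ a ∈ Λ, ∀ x, ∀ w ∈ U, w ≠ a →
      evalAt U k w (R a x).2 = (evalAt U k a x.2 - evalAt U k w x.2) / (w - a))
    {f : ℝ → ℂ} {u : ℝ → ℂ → ℂ} {C D : ℝ} (hC : 0 ≤ C) (hD : 0 ≤ D) (hf : ∀ s, ‖f s‖ ≤ C)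
    (hu : ∀ s, DifferentiableOn ℂ (u s) U) (hub : ∀ s, 0 ≤ s → ∀ z ∈ U, ‖u s z‖ ≤ C * k z)
    (hfc : ∀ s a, 0 ≤ a → a ≤ 1 → ‖f (s + a) - f s‖ ≤ D * a)
    (huc : ∀ s a, 0 ≤ s → 0 ≤ a → a ≤ 1 → ∀ z ∈ U, ‖u (s + a) z - u s z‖ ≤ D * a * k z)
    (hode : ∀ s h, 0 ≤ s → 0 ≤ h → ∀ z ∈ U,
      u (s + h) z - u s z = ∫ r in (0 : ℝ)..h, (z * u (s + r) z - f (s + r))) :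
    ∃ g : mildSolutions Λ R, ‖g‖ ≤ C ∧ ∀ s : ℝ≥0, ((g : ℝ≥0 →ᵇ ℂ × weightedAnalytic U k) s).1 = f s ∧
      ∀ z ∈ U, evalAt U k z ((g : ℝ≥0 →ᵇ ℂ × weightedAnalytic U k) s).2 = u s z := by
  have : CompleteSpace (weightedAnalytic U k) :=
    (isClosed_weightedAnalytic hU hk).completeSpace_coe
  have h1 : ∀ s : ℝ≥0, ∃ φ : weightedAnalytic U k,
      (∀ z ∈ U, evalAt U k z φ = u s z) ∧ ‖φ‖ ≤ C := fun s =>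
    exists_weightedAnalytic hk hk0 (hu s) hC (hub s s.2)
  choose φ hφ hφn using h1
  have hφd : ∀ s a : ℝ≥0, a ≤ 1 → ‖φ (s + a) - φ s‖ ≤ D * a := fun s a ha => by
    obtain ⟨ψ, hψ, hψn⟩ := exists_weightedAnalytic hk hk0 ((hu (s + a)).sub (hu s))
      (C := D * a) (by positivity) (huc s a s.2 a.2 ha)
    rwa [show φ (s + a) - φ s = ψ from weightedAnalytic_ext hU hk0 ∅ finite_empty fun z hz _ => by
      rw [map_sub, hφ _ z hz, hφ _ z hz, hψ z hz, NNReal.coe_add]; rfl]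
  have hlip : ∀ s a : ℝ≥0, a ≤ 1 → ‖(f ((s + a : ℝ≥0) : ℝ), φ (s + a)) - (f s, φ s)‖ ≤ D * a :=
    fun s a ha => max_le (by simpa using hfc s a a.2 ha) (hφd s a ha)
  have huc' : UniformContinuous fun s : ℝ≥0 => ((f s, φ s) : ℂ × weightedAnalytic U k) := by
    refine Metric.uniformContinuous_iff.2 fun ε hε => ⟨min 1 (ε / (D + 1)), by positivity, ?_⟩
    have key : ∀ s t : ℝ≥0, s ≤ t → dist s t < min 1 (ε / (D + 1)) →
        dist ((f s, φ s) : ℂ × weightedAnalytic U k) (f t, φ t) < ε := fun s t hst hd => by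
      obtain ⟨a, rfl⟩ := exists_add_of_le hst
      have hda : dist s (s + a) = a := by simp [NNReal.dist_eq]
      rw [hda, lt_min_iff] at hd
      rw [dist_comm, dist_eq_norm]
      refine (hlip s a (by exact_mod_cast hd.1.le)).trans_lt ?_
      calc D * a ≤ (D + 1) * a := by gcongr; linarith
        _ < (D + 1) * (ε / (D + 1)) := by gcongr; exact hd.2
        _ = ε := by field_simp
    intro s t hd
    rcases le_total s t with h | h
    · exact key s t h hd
    · rw [dist_comm] at hd ⊢
      exact key t s h hd
  set g : ℝ≥0 →ᵇ (ℂ × weightedAnalytic U k) := BoundedContinuousFunction.ofNormedAddCommGroup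
    (fun s : ℝ≥0 => (f s, φ s)) huc'.continuous C fun s => max_le (hf s) (hφn s) with hg
  have hg1 : ∀ s, (g s).1 = f s := fun s => rfl
  have hg2 : ∀ s, ∀ z ∈ U, evalAt U k z (g s).2 = u s z := fun s z hz => hφ s z hz
  refine ⟨⟨g, huc', fun a ha s h => ?_⟩, ?_, fun s => ⟨hg1 s, hg2 s⟩⟩
  · have hi : IntervalIntegrable (fun r : ℝ => a • R a (g (s + r.toNNReal)) -
        g (s + r.toNNReal)) MeasureTheory.volume 0 h :=
      Continuous.intervalIntegrable (by fun_prop) _ _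
    have hcu : ∀ z ∈ U, IntervalIntegrable (fun r : ℝ => z * u (s + r) z - f (s + r))
        MeasureTheory.volume 0 h := fun z hz => by
      have : Continuous fun r : ℝ => z * evalAt U k z (g (s + r.toNNReal)).2 -
          (g (s + r.toNNReal)).1 := by fun_prop
      refine IntervalIntegrable.congr (fun r hr => ?_) (this.intervalIntegrable 0 h)
      rw [uIoc_of_le h.coe_nonneg] at hr
      simp only [hg1, hg2 _ z hz, NNReal.coe_add, Real.coe_toNNReal r hr.1.le]
    have hr0 : ∀ r ∈ uIcc (0 : ℝ) h, ((s + r.toNNReal : ℝ≥0) : ℝ) = s + r := fun r hr => by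
      rw [uIcc_of_le h.coe_nonneg] at hr
      rw [NNReal.coe_add, Real.coe_toNNReal r hr.1]
    -- The first component is the equation for u at the point a. The second is the difference of the
    -- equations at a and at z, divided by z - a; the term f cancels.
    refine Prod.ext ?_ (weightedAnalytic_ext hU hk0 {a} (finite_singleton a) fun z hz hza => ?_)
    · have e1 := (ContinuousLinearMap.fst ℂ ℂ (weightedAnalytic U k)).intervalIntegral_comp_comm hi
      rw [ContinuousLinearMap.coe_fst'] at e1
      rw [← e1, hR1 a ha, Prod.snd_sub, map_sub, hg2 _ a (hΛ ha), hg2 _ a (hΛ ha),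
        NNReal.coe_add, hode s h s.2 h.2 a (hΛ ha)]
      refine intervalIntegral.integral_congr fun r hr => ?_
      simp only [Prod.fst_sub, Prod.smul_fst, hR1 a ha, hg1, hg2 _ a (hΛ ha), hr0 r hr,
        smul_eq_mul]
    · have hza' : z ≠ a := hza
      have e1 := ((evalAt U k z).comp
        (ContinuousLinearMap.snd ℂ ℂ (weightedAnalytic U k))).intervalIntegral_comp_comm hi
      simp only [ContinuousLinearMap.coe_comp, ContinuousLinearMap.coe_snd',
        Function.comp] at e1
      have h4 : z - a ≠ 0 := sub_ne_zero.2 hza'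
      rw [← e1, hR2 a ha _ z hz hza', Prod.snd_sub, map_sub, map_sub, hg2 _ a (hΛ ha),
        hg2 _ a (hΛ ha), hg2 _ z hz, hg2 _ z hz, NNReal.coe_add, hode s h s.2 h.2 a (hΛ ha),
        hode s h s.2 h.2 z hz, ← intervalIntegral.integral_sub (hcu a (hΛ ha)) (hcu z hz),
        ← intervalIntegral.integral_div]
      refine intervalIntegral.integral_congr fun r hr => ?_
      simp only [Prod.snd_sub, Prod.smul_snd, map_sub, map_smul, hR2 a ha _ z hz hza',
        hg2 _ a (hΛ ha), hg2 _ z hz, hr0 r hr, smul_eq_mul]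
      field_simp
      ring
  · exact (BoundedContinuousFunction.norm_le hC).2 fun s => max_le (hf s) (hφn s)

end Resolvents

end SemigroupDecay

namespace SemigroupDecay

open MeasureTheory

/-! ### Decay and Mellin inversion of the Gamma function on vertical lines -/

theorem integrableOn_laplace {φ : ℝ → ℂ} {x : ℝ}
    (hφ : IntegrableOn (fun r : ℝ => φ r * Complex.exp (-(x * r))) (Ioi 0)) {z : ℂ}
    (hz : x ≤ z.re) : IntegrableOn (fun r : ℝ => φ r * Complex.exp (-(z * r))) (Ioi 0) := by
  have e : ∀ r : ℝ, φ r * Complex.exp (-(z * r)) =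
      φ r * Complex.exp (-(x * r)) * Complex.exp (-((z - x) * r)) := fun r => by
    rw [mul_assoc, ← Complex.exp_add]
    congr 2
    ring
  simp only [e]
  refine Integrable.mono hφ (hφ.aestronglyMeasurable.mul (by fun_prop)) ?_
  refine (ae_restrict_iff' measurableSet_Ioi).2 (Eventually.of_forall fun r hr => ?_)
  rw [norm_mul]
  refine mul_le_of_le_one_right (norm_nonneg _) ?_
  rw [Complex.norm_exp]
  refine Real.exp_le_one_iff.2 ?_
  have hr' : (0 : ℝ) < r := hr
  simp
  exact mul_nonneg (by linarith) hr'.le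

/-- A Laplace transform is analytic in the half plane where it converges absolutely. -/
theorem differentiableOn_laplace {φ : ℝ → ℂ} {x₀ : ℝ}
    (hφ : ∀ x : ℝ, x₀ < x → IntegrableOn (fun r : ℝ => φ r * Complex.exp (-(x * r))) (Ioi 0)) :
    DifferentiableOn ℂ (fun z : ℂ => ∫ r in Ioi (0 : ℝ), φ r * Complex.exp (-(z * r)))
      {z | x₀ < z.re} := by
  intro z hz
  have hz' : x₀ < z.re := hz
  set d : ℝ := (z.re - x₀) / 4 with hd
  have hd0 : 0 < d := by linarith
  set x : ℝ := x₀ + d with hx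
  have hxi := hφ x (by linarith)
  have hs : {w : ℂ | x + d < w.re} ∈ 𝓝 z :=
    (isOpen_lt continuous_const Complex.continuous_re).mem_nhds
      (show x + d < z.re by linarith)
  have hmeas : ∀ w : ℂ, AEStronglyMeasurable
      (fun r : ℝ => φ r * Complex.exp (-(w * r))) (volume.restrict (Ioi 0)) := fun w => by
    have e : (fun r : ℝ => φ r * Complex.exp (-(w * r))) = fun r : ℝ =>
        φ r * Complex.exp (-(x * r)) * Complex.exp (-((w - x) * r)) := by
      ext r
      rw [mul_assoc, ← Complex.exp_add]
      congr 2
      ring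
    rw [e]
    exact hxi.aestronglyMeasurable.mul (by fun_prop)
  have key := hasDerivAt_integral_of_dominated_loc_of_deriv_le (μ := volume.restrict (Ioi 0))
    (F := fun (w : ℂ) (r : ℝ) => φ r * Complex.exp (-(w * r)))
    (F' := fun (w : ℂ) (r : ℝ) => φ r * Complex.exp (-(w * r)) * (-(r : ℂ)))
    (bound := fun r => d⁻¹ * ‖φ r * Complex.exp (-(x * r))‖) (x₀ := z) hs
    (Eventually.of_forall hmeas) (integrableOn_laplace hxi (show x ≤ z.re by linarith))
    ((hmeas z).mul (by fun_prop)) ?_ (hxi.norm.const_mul _) ?_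
  · exact key.2.differentiableAt.differentiableWithinAt
  · refine (ae_restrict_iff' measurableSet_Ioi).2 (Eventually.of_forall fun r hr w hw => ?_)
    have hr' : (0 : ℝ) < r := hr
    have hw' : x + d < w.re := hw
    rw [norm_mul, norm_mul, norm_mul, norm_neg, Complex.norm_real, Real.norm_of_nonneg hr'.le,
      Complex.norm_exp, Complex.norm_exp]
    have h1 : (-(w * r)).re = -(w.re * r) := by simp
    have h2 : (-((x : ℂ) * r)).re = -(x * r) := by simp
    rw [h1, h2]
    -- The factor r produced by differentiation is paid for by the spare margin d in the exponent.
    have h3 : d * r ≤ Real.exp (d * r) := by linarith [Real.add_one_le_exp (d * r)]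
    have h4 : Real.exp (-(w.re * r)) * r ≤ d⁻¹ * Real.exp (-(x * r)) := by
      rw [inv_mul_eq_div, le_div_iff₀ hd0]
      calc Real.exp (-(w.re * r)) * r * d = Real.exp (-(w.re * r)) * (d * r) := by ring
        _ ≤ Real.exp (-(w.re * r)) * Real.exp (d * r) := by gcongr
        _ = Real.exp (-((w.re - d) * r)) := by rw [← Real.exp_add]; congr 1; ring
        _ ≤ Real.exp (-(x * r)) := by gcongr; linarith
    calc ‖φ r‖ * Real.exp (-(w.re * r)) * r = ‖φ r‖ * (Real.exp (-(w.re * r)) * r) := by ring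
      _ ≤ ‖φ r‖ * (d⁻¹ * Real.exp (-(x * r))) := by gcongr
      _ = _ := by ring
  · refine Eventually.of_forall fun r w _ => ?_
    have h1 : HasDerivAt (fun w : ℂ => -(w * r)) (-(r : ℂ)) w := by
      simpa using ((hasDerivAt_id w).mul_const (r : ℂ)).fun_neg
    simpa [mul_assoc] using (h1.cexp.const_mul (φ r))

theorem integrableOn_cpow_mul_exp {a : ℂ} (ha : 0 < a.re) {x : ℝ} (hx : 0 < x) :
    IntegrableOn (fun t : ℝ => (t : ℂ) ^ (a - 1) * Complex.exp (-(x * t))) (Ioi 0) := by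
  have h1 := integrableOn_rpow_mul_exp_neg_mul_rpow (p := 1) (s := a.re - 1) (b := x)
    (by linarith) (by norm_num) hx
  refine Integrable.mono' h1 ?_ ?_
  · refine (ContinuousOn.mul ?_ (by fun_prop)).aestronglyMeasurable measurableSet_Ioi
    intro t ht
    exact (Complex.continuousAt_ofReal_cpow_const t (a - 1)
      (Or.inr (ne_of_gt ht))).continuousWithinAt
  · refine (ae_restrict_iff' measurableSet_Ioi).2 (Eventually.of_forall fun t ht => ?_)
    have ht' : (0 : ℝ) < t := ht
    rw [norm_mul, Complex.norm_cpow_eq_rpow_re_of_pos ht', Complex.norm_exp]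
    simp

/-- Both sides are analytic in r on the right half plane and agree for real r > 1, which accumulate
at 1. -/
theorem integral_cpow_mul_exp_neg_mul {a r : ℂ} (ha : 0 < a.re) (hr : 0 < r.re) :
    ∫ t in Ioi (0 : ℝ), (t : ℂ) ^ (a - 1) * Complex.exp (-(r * t)) =
      r ^ (-a) * Complex.Gamma a := by
  have hopen : IsOpen {z : ℂ | 0 < z.re} := isOpen_lt continuous_const Complex.continuous_re
  have h1 : DifferentiableOn ℂ (fun z : ℂ => ∫ t in Ioi (0 : ℝ),
      (t : ℂ) ^ (a - 1) * Complex.exp (-(z * t))) {z | 0 < z.re} :=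
    differentiableOn_laplace fun x hx => integrableOn_cpow_mul_exp ha hx
  have h2 : DifferentiableOn ℂ (fun z : ℂ => z ^ (-a) * Complex.Gamma a) {z | 0 < z.re} := by
    intro z hz
    refine DifferentiableAt.differentiableWithinAt ?_
    exact (differentiableAt_id.cpow_const (Or.inl hz)).mul_const _
  have hconn : IsPreconnected {z : ℂ | 0 < z.re} := (convex_halfSpace_re_gt 0).isPreconnected
  have hfreq : ∃ᶠ z in 𝓝[≠] (1 : ℂ), (∫ t in Ioi (0 : ℝ),
      (t : ℂ) ^ (a - 1) * Complex.exp (-(z * t))) = z ^ (-a) * Complex.Gamma a := by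
    have ht : Tendsto (fun x : ℝ => (x : ℂ)) (𝓝[>] 1) (𝓝[≠] (1 : ℂ)) := by
      refine tendsto_nhdsWithin_iff.2 ⟨?_, ?_⟩
      · have : Tendsto (fun x : ℝ => (x : ℂ)) (𝓝 1) (𝓝 ((1 : ℝ) : ℂ)) :=
          Complex.continuous_ofReal.tendsto 1
        exact this.mono_left nhdsWithin_le_nhds
      · filter_upwards [self_mem_nhdsWithin] with x hx
        have hx' : (1 : ℝ) < x := hx
        simpa using hx'.ne'
    refine ht.frequently (Eventually.frequently ?_)
    filter_upwards [self_mem_nhdsWithin] with x hx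
    have hx' : (1 : ℝ) < x := hx
    have hx0 : 0 < x := by linarith
    rw [Complex.integral_cpow_mul_exp_neg_mul_Ioi ha hx0, one_div, Complex.cpow_neg,
      Complex.inv_cpow]
    rw [Complex.arg_ofReal_of_nonneg hx0.le]
    exact Real.pi_pos.ne
  exact (h1.analyticOnNhd hopen).eqOn_of_preconnected_of_frequently_eq (h2.analyticOnNhd hopen)
    hconn (show (1 : ℂ) ∈ {z : ℂ | 0 < z.re} by simp) hfreq hr

theorem integral_cpow_mul_exp_neg_exp_mul {a w : ℂ} (ha : 0 < a.re) (hw : |w.im| < Real.pi / 2) :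
    ∫ t in Ioi (0 : ℝ), (t : ℂ) ^ (a - 1) * Complex.exp (-(Complex.exp w * t)) =
      Complex.exp (-(a * w)) * Complex.Gamma a := by
  have hw' := abs_lt.1 hw
  rw [integral_cpow_mul_exp_neg_mul ha, Complex.cpow_def_of_ne_zero (Complex.exp_ne_zero _),
    Complex.log_exp (by linarith [Real.pi_pos]) (by linarith [Real.pi_pos])]
  · congr 2
    ring
  · rw [Complex.exp_re]
    exact mul_pos (Real.exp_pos _) (Real.cos_pos_of_mem_Ioo ⟨by linarith, hw'.2⟩)

theorem one_lt_pi_div_two : (1 : ℝ) < Real.pi / 2 := by linarith [Real.pi_gt_three]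

/-- Exponential decay of the Gamma function on vertical lines. -/
theorem norm_Gamma_le {a : ℂ} (ha : 0 < a.re) :
    ‖Complex.Gamma a‖ ≤ Real.exp (-|a.im|) * ((1 / Real.cos 1) ^ a.re * Real.Gamma a.re) := by
  have hc : 0 < Real.cos 1 := Real.cos_one_pos
  -- Turning the ray of the Gamma integral through the angle ±1 produces the factor exp(± Im a),
  -- while cos 1 > 0 keeps the integral convergent. The sign is chosen afterwards to match that of
  -- Im a.
  have key : ∀ e : ℝ, |e| = 1 → Real.exp (e * a.im) * ‖Complex.Gamma a‖ ≤
      (1 / Real.cos 1) ^ a.re * Real.Gamma a.re := fun e he => by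
    have h1 := integral_cpow_mul_exp_neg_exp_mul (w := e * Complex.I) ha
      (by simpa [he] using one_lt_pi_div_two)
    have h2 : ‖Complex.exp (-(a * (e * Complex.I)))‖ = Real.exp (e * a.im) := by
      rw [Complex.norm_exp]
      congr 1
      simp
      ring
    rw [← h2, ← norm_mul, ← h1, ← Real.integral_rpow_mul_exp_neg_mul_Ioi ha hc]
    refine (norm_integral_le_integral_norm _).trans_eq ?_
    refine setIntegral_congr_fun measurableSet_Ioi fun t ht => ?_
    have ht' : (0 : ℝ) < t := ht
    have h3 : (-(Complex.exp (e * Complex.I) * t)).re = -(Real.cos 1 * t) := by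
      rw [Complex.neg_re, Complex.re_mul_ofReal, Complex.exp_ofReal_mul_I_re, ← Real.cos_abs, he]
    change ‖_ * _‖ = _
    rw [norm_mul, Complex.norm_cpow_eq_rpow_re_of_pos ht', Complex.norm_exp, h3]
    simp
  have hfin : Real.exp |a.im| * ‖Complex.Gamma a‖ ≤ (1 / Real.cos 1) ^ a.re * Real.Gamma a.re := by
    rcases le_total 0 a.im with h | h
    · simpa [abs_of_nonneg h] using key 1 (by simp)
    · simpa [abs_of_nonpos h] using key (-1) (by simp)
  rw [Real.exp_neg, inv_mul_eq_div, le_div_iff₀' (Real.exp_pos _)]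
  exact hfin

theorem integrable_exp_neg_mul_abs {c : ℝ} (hc : 0 < c) (t : ℝ) :
    Integrable fun s : ℝ => Real.exp (-(c * |s - t|)) := by
  have h0 : Integrable fun s : ℝ => Real.exp (-(c * |s|)) := by
    rw [← integrableOn_univ, ← Iic_union_Ioi (a := (0 : ℝ))]
    refine IntegrableOn.union ?_ ?_
    · refine (integrableOn_exp_mul_Iic hc 0).congr_fun (fun s hs => ?_) measurableSet_Iic
      rw [abs_of_nonpos hs]
      ring_nf
    · refine (integrableOn_exp_mul_Ioi (neg_lt_zero.2 hc) 0).congr_fun (fun s hs => ?_)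
        measurableSet_Ioi
      rw [abs_of_pos hs]
      ring_nf
  exact h0.comp_sub_right t

theorem integral_exp_neg_mul_abs {c : ℝ} (hc : 0 < c) (t : ℝ) :
    ∫ s : ℝ, Real.exp (-(c * |s - t|)) = 2 / c := by
  rw [integral_sub_right_eq_self (fun s => Real.exp (-(c * |s|))) t,
    integral_comp_abs (f := fun s => Real.exp (-(c * s)))]
  have := integral_exp_mul_Ioi (neg_lt_zero.2 hc) 0
  simp only [neg_mul, mul_zero, Real.exp_zero] at this
  rw [this]
  field_simp

theorem continuous_Gamma_vertical {σ : ℝ} (hσ : 0 < σ) :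
    Continuous fun y : ℝ => Complex.Gamma (σ + y * Complex.I) := by
  refine continuous_iff_continuousAt.2 fun y => ?_
  have h1 : ContinuousAt Complex.Gamma (σ + y * Complex.I) :=
    (Complex.differentiableAt_Gamma _ fun m h => by
      have := congrArg Complex.re h
      simp at this
      have hm : (0 : ℝ) ≤ m := m.cast_nonneg
      linarith).continuousAt
  exact ContinuousAt.comp (f := fun y : ℝ => (σ + y * Complex.I : ℂ)) h1 (by fun_prop)

/-- The exponential grows at most like exp(|y| |Im w|), against the decay exp(-|y|) from
`norm_Gamma_le`; hence the restriction |Im w| < 1. -/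
theorem integrable_exp_mul_Gamma {σ : ℝ} (hσ : 0 < σ) {w : ℂ} (hw : |w.im| < 1) :
    Integrable fun y : ℝ => Complex.exp (-((σ + y * Complex.I) * w)) *
      Complex.Gamma (σ + y * Complex.I) := by
  have h1 := (integrable_exp_neg_mul_abs (sub_pos.2 hw) 0).const_mul
    (Real.exp (-(σ * w.re)) * ((1 / Real.cos 1) ^ σ * Real.Gamma σ))
  have hc := continuous_Gamma_vertical hσ
  refine h1.mono' (Continuous.aestronglyMeasurable (by fun_prop)) (Eventually.of_forall fun y => ?_)
  have h2 : ‖Complex.Gamma (σ + y * Complex.I)‖ ≤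
      Real.exp (-|y|) * ((1 / Real.cos 1) ^ σ * Real.Gamma σ) := by
    have := norm_Gamma_le (a := σ + y * Complex.I) (by simpa using hσ)
    simpa using this
  have h3 : (-((σ + y * Complex.I) * w)).re = -(σ * w.re) + y * w.im := by
    simp
    ring
  have h4 : y * w.im ≤ |y| * |w.im| := by rw [← abs_mul]; exact le_abs_self _
  have hG : 0 ≤ (1 / Real.cos 1) ^ σ * Real.Gamma σ := by
    have := Real.cos_one_pos
    have := Real.Gamma_pos_of_pos hσ
    positivity
  rw [norm_mul, Complex.norm_exp, h3, sub_zero]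
  calc Real.exp (-(σ * w.re) + y * w.im) * ‖Complex.Gamma (σ + y * Complex.I)‖
      ≤ Real.exp (-(σ * w.re) + |y| * |w.im|) *
        (Real.exp (-|y|) * ((1 / Real.cos 1) ^ σ * Real.Gamma σ)) := by gcongr
    _ = Real.exp (-(σ * w.re)) * ((1 / Real.cos 1) ^ σ * Real.Gamma σ) *
        Real.exp (-((1 - |w.im|) * |y|)) := by
      rw [Real.exp_add, show -((1 - |w.im|) * |y|) = |y| * |w.im| + -|y| by ring, Real.exp_add]
      ring

/-- Mellin inversion for the Gamma function at the complex point `exp w`. -/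
theorem integral_exp_mul_Gamma {σ : ℝ} (hσ : 0 < σ) {w : ℂ} (hw : |w.im| < 1) :
    ∫ y : ℝ, Complex.exp (-((σ + y * Complex.I) * w)) * Complex.Gamma (σ + y * Complex.I) =
      2 * Real.pi * Complex.exp (-Complex.exp w) := by
  have hmel : ∀ y : ℝ, mellin (fun t : ℝ => Complex.exp (-(Complex.exp w * t)))
      (σ + y * Complex.I) = Complex.exp (-((σ + y * Complex.I) * w)) *
        Complex.Gamma (σ + y * Complex.I) := fun y => by
    rw [mellin]
    exact integral_cpow_mul_exp_neg_exp_mul (by simpa using hσ) (hw.trans one_lt_pi_div_two)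
  have hre : 0 < (Complex.exp w).re := by
    have hw' := abs_lt.1 hw
    rw [Complex.exp_re]
    exact mul_pos (Real.exp_pos _) (Real.cos_pos_of_mem_Ioo
      ⟨by linarith [one_lt_pi_div_two], by linarith [one_lt_pi_div_two]⟩)
  -- The function t ↦ exp(-e^w t) has Mellin transform e^{-aw} Γ(a); inversion is evaluated at t =
  -- 1.
  have h1 := mellinInv_mellin_eq σ (fun t : ℝ => Complex.exp (-(Complex.exp w * t)))
    (x := 1) one_pos ?_ ?_ (by fun_prop)
  · rw [mellinInv] at h1
    simp only [hmel, Complex.ofReal_one, Complex.one_cpow, one_smul, mul_one] at h1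
    generalize (∫ y : ℝ, Complex.exp (-((σ + y * Complex.I) * w)) *
      Complex.Gamma (σ + y * Complex.I)) = J at h1 ⊢
    rw [← h1, Complex.real_smul]
    push_cast
    have := Complex.ofReal_ne_zero.2 Real.pi_pos.ne'
    field_simp
  · exact integrableOn_laplace (integrableOn_cpow_mul_exp (a := σ) (by simpa using hσ) hre) le_rfl
  · rw [Complex.VerticalIntegrable]
    simp only [hmel]
    exact integrable_exp_mul_Gamma hσ hw

end SemigroupDecay

namespace SemigroupDecay

open MeasureTheory
open scoped NNReal BoundedContinuousFunction

/-! ### Orbits of exponentially localised functions -/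

/-- The Laplace transform at `z` of the translate `F (s + ·)`. -/
def laplaceShift (F : ℝ → ℂ) (s : ℝ) (z : ℂ) : ℂ :=
  ∫ r in Ioi (0 : ℝ), F (s + r) * Complex.exp (-(z * r))

/-- The two-sided Laplace transform. -/
def twoSided (F : ℝ → ℂ) (z : ℂ) : ℂ := ∫ r : ℝ, F r * Complex.exp (-(z * r))

section Localised

variable {F : ℝ → ℂ} {B κ t : ℝ}

theorem integrable_of_localised (hκ : 0 < κ) (hF : Continuous F)
    (hb : ∀ s, ‖F s‖ ≤ B * Real.exp (-(κ * |s - t|))) : Integrable F :=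
  ((integrable_exp_neg_mul_abs hκ t).const_mul B).mono' hF.aestronglyMeasurable
    (Eventually.of_forall hb)

theorem integral_norm_le_of_localised (hκ : 0 < κ) (hF : Continuous F)
    (hb : ∀ s, ‖F s‖ ≤ B * Real.exp (-(κ * |s - t|))) : ∫ s, ‖F s‖ ≤ B * (2 / κ) := by
  rw [← integral_exp_neg_mul_abs hκ t, ← integral_const_mul]
  exact integral_mono (integrable_of_localised hκ hF hb).norm
    ((integrable_exp_neg_mul_abs hκ t).const_mul B) hb

theorem integrable_mul_exp_of_localised (hF : Continuous F)
    (hb : ∀ s, ‖F s‖ ≤ B * Real.exp (-(κ * |s - t|))) {z : ℂ} (hz : |z.re| < κ) :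
    Integrable fun r : ℝ => F r * Complex.exp (-(z * r)) := by
  have h1 := (integrable_exp_neg_mul_abs (sub_pos.2 hz) t).const_mul
    (B * Real.exp (-(z.re * t)))
  refine h1.mono' (by fun_prop) (Eventually.of_forall fun r => ?_)
  have h2 : (-(z * r)).re = -(z.re * r) := by simp
  have h3 : -(z.re * (r - t)) ≤ |z.re| * |r - t| := by
    rw [← abs_mul]
    exact neg_le_abs _
  have hB : 0 ≤ B := nonneg_of_mul_nonneg_left ((norm_nonneg _).trans (hb r)) (Real.exp_pos _)
  rw [norm_mul, Complex.norm_exp, h2]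
  calc ‖F r‖ * Real.exp (-(z.re * r))
      ≤ B * Real.exp (-(κ * |r - t|)) * Real.exp (-(z.re * t) + |z.re| * |r - t|) := by
        gcongr
        · exact hb r
        · linarith
    _ = B * Real.exp (-(z.re * t)) * Real.exp (-((κ - |z.re|) * |r - t|)) := by
        rw [mul_assoc, mul_assoc, ← Real.exp_add, ← Real.exp_add]
        congr 2
        ring

theorem localised_shift (hb : ∀ s, ‖F s‖ ≤ B * Real.exp (-(κ * |s - t|))) (s : ℝ) :
    ∀ r, ‖F (s + r)‖ ≤ B * Real.exp (-(κ * |r - (t - s)|)) := fun r => by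
  rw [show r - (t - s) = s + r - t by ring]
  exact hb (s + r)

theorem integrableOn_laplaceShift (hκ : 0 < κ) (hF : Continuous F)
    (hb : ∀ s, ‖F s‖ ≤ B * Real.exp (-(κ * |s - t|))) (s : ℝ) {z : ℂ} (hz : -κ < z.re) :
    IntegrableOn (fun r : ℝ => F (s + r) * Complex.exp (-(z * r))) (Ioi 0) := by
  have h1 : |min z.re 0| < κ := by
    rw [abs_of_nonpos (min_le_right _ _), neg_lt]
    exact lt_min hz (by linarith)
  exact integrableOn_laplace (x := min z.re 0) (integrable_mul_exp_of_localised
    (F := fun r => F (s + r)) (by fun_prop) (localised_shift hb s)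
    (by simpa using h1)).integrableOn (min_le_left _ _)

theorem differentiableOn_laplaceShift (hκ : 0 < κ) (hF : Continuous F)
    (hb : ∀ s, ‖F s‖ ≤ B * Real.exp (-(κ * |s - t|))) (s : ℝ) :
    DifferentiableOn ℂ (laplaceShift F s) {z | -κ < z.re} :=
  differentiableOn_laplace fun x hx => integrableOn_laplaceShift hκ hF hb s (by simpa using hx)

theorem laplaceShift_add (hκ : 0 < κ) (hF : Continuous F)
    (hb : ∀ s, ‖F s‖ ≤ B * Real.exp (-(κ * |s - t|))) (s : ℝ) {h : ℝ} (hh : 0 ≤ h) {z : ℂ}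
    (hz : -κ < z.re) :
    laplaceShift F (s + h) z = Complex.exp (z * h) *
      (laplaceShift F s z - ∫ r in (0 : ℝ)..h, F (s + r) * Complex.exp (-(z * r))) := by
  have hi := integrableOn_laplaceShift hκ hF hb s hz
  have h1 := intervalIntegral.integral_interval_add_Ioi hi
    (hi.mono_set (Ioi_subset_Ioi hh))
  have h2 := (measurePreserving_add_right volume h).setIntegral_preimage_emb
    (measurableEmbedding_addRight h) (fun r : ℝ => F (s + r) * Complex.exp (-(z * r))) (Ioi h)
  rw [preimage_add_const_Ioi, sub_self] at h2
  rw [laplaceShift, laplaceShift, ← h1, add_sub_cancel_left, ← h2, ← integral_const_mul]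
  refine setIntegral_congr_fun measurableSet_Ioi fun r _ => ?_
  change _ = Complex.exp (z * h) * (F (s + (r + h)) * Complex.exp (-(z * ((r + h : ℝ) : ℂ))))
  rw [mul_left_comm, ← Complex.exp_add, add_right_comm, add_assoc s]
  congr 2
  push_cast
  ring

theorem laplaceShift_sub (hκ : 0 < κ) (hF : Continuous F)
    (hb : ∀ s, ‖F s‖ ≤ B * Real.exp (-(κ * |s - t|))) (s : ℝ) {h : ℝ} (hh : 0 ≤ h) {z : ℂ}
    (hz : -κ < z.re) :
    laplaceShift F (s + h) z - laplaceShift F s z =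
      ∫ r in (0 : ℝ)..h, (z * laplaceShift F (s + r) z - F (s + r)) := by
  -- The formula of `laplaceShift_add` makes sense for every real x, so v has a two-sided derivative
  -- even at 0.
  set v : ℝ → ℂ := fun x => Complex.exp (z * x) *
    (laplaceShift F s z - ∫ r in (0 : ℝ)..x, F (s + r) * Complex.exp (-(z * r))) with hv
  have hvd : ∀ x : ℝ, HasDerivAt v (z * v x - F (s + x)) x := fun x => by
    have h1 : HasDerivAt (fun x : ℝ => Complex.exp (z * x)) (Complex.exp (z * x) * z) x := by
      have := ((hasDerivAt_id (x : ℂ)).const_mul z).cexp.comp_ofReal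
      simpa using this
    have h2 : HasDerivAt (fun x : ℝ => ∫ r in (0 : ℝ)..x, F (s + r) * Complex.exp (-(z * r)))
        (F (s + x) * Complex.exp (-(z * x))) x := by
      have hc : Continuous fun r : ℝ => F (s + r) * Complex.exp (-(z * r)) := by fun_prop
      exact intervalIntegral.integral_hasDerivAt_right (hc.intervalIntegrable _ _)
        (hc.stronglyMeasurableAtFilter _ _) hc.continuousAt
    have h3 := h1.mul (h2.const_sub (laplaceShift F s z))
    have e : Complex.exp (z * x) * Complex.exp (-(z * x)) = 1 := by
      rw [← Complex.exp_add, add_neg_cancel, Complex.exp_zero]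
    refine h3.congr_deriv ?_
    simp only [hv]
    linear_combination (-F (s + x)) * e
  have hvc : Continuous v := continuous_iff_continuousAt.2 fun x => (hvd x).continuousAt
  have hve : ∀ x, 0 ≤ x → v x = laplaceShift F (s + x) z := fun x hx =>
    (laplaceShift_add hκ hF hb s hx hz).symm
  have h4 := intervalIntegral.integral_eq_sub_of_hasDerivAt (a := 0) (b := h)
    (fun x _ => hvd x) (Continuous.intervalIntegrable (by fun_prop) _ _)
  rw [hve h hh, hve 0 le_rfl, add_zero] at h4
  rw [← h4]
  refine intervalIntegral.integral_congr fun r hr => ?_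
  rw [uIcc_of_le hh] at hr
  simp only [hve r hr.1]

/-- For Re z ≤ 0 the one-sided transform is e^{zs} times the two-sided one, minus the integral over
r ≤ 0, where |e^{-zr}| ≤ 1. As |e^{zs}| ≤ 1, the bound is uniform in s ≥ 0. For Re z ≥ 0 the
integral is bounded directly. -/
theorem norm_laplaceShift_le (hκ : 0 < κ) (hF : Continuous F)
    (hb : ∀ s, ‖F s‖ ≤ B * Real.exp (-(κ * |s - t|))) {s : ℝ} (hs : 0 ≤ s) {z : ℂ}
    (hz : -κ < z.re) {E : ℝ} (hE : 0 ≤ E) (hG : z.re ≤ 0 → ‖twoSided F z‖ ≤ E) :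
    ‖laplaceShift F s z‖ ≤ E + B * (2 / κ) := by
  have hint : Integrable fun r => F (s + r) :=
    integrable_of_localised hκ (by fun_prop) (localised_shift hb s)
  have hnorm : ∫ r, ‖F (s + r)‖ ≤ B * (2 / κ) :=
    integral_norm_le_of_localised (F := fun r => F (s + r)) hκ (by fun_prop) (localised_shift hb s)
  have hset : ∀ S : Set ℝ, MeasurableSet S → (∀ r ∈ S, 0 ≤ z.re * r) →
      ‖∫ r in S, F (s + r) * Complex.exp (-(z * r))‖ ≤ B * (2 / κ) := fun S hS hS' => by
    refine (norm_integral_le_of_norm_le hint.norm.integrableOn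
      ((ae_restrict_iff' hS).2 (Eventually.of_forall fun r hr => ?_))).trans
      ((setIntegral_le_integral hint.norm
        (Eventually.of_forall fun r => norm_nonneg _)).trans hnorm)
    rw [norm_mul, Complex.norm_exp]
    refine mul_le_of_le_one_right (norm_nonneg _) (Real.exp_le_one_iff.2 ?_)
    simpa using hS' r hr
  rcases le_total z.re 0 with h0 | h0
  · have hi := integrable_mul_exp_of_localised (F := fun r => F (s + r)) (by fun_prop)
      (localised_shift hb s) (z := z) (by rw [abs_of_nonpos h0]; linarith)
    have h1 := intervalIntegral.integral_Iic_add_Ioi (b := 0) hi.integrableOn hi.integrableOn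
    have h2 : ∫ r : ℝ, F (s + r) * Complex.exp (-(z * r)) =
        Complex.exp (z * s) * twoSided F z := by
      rw [twoSided, ← integral_const_mul,
        ← integral_add_left_eq_self (fun r : ℝ => Complex.exp (z * s) *
          (F r * Complex.exp (-(z * r)))) s]
      refine integral_congr_ae (Eventually.of_forall fun r => ?_)
      change _ = Complex.exp (z * s) * (F (s + r) * Complex.exp (-(z * ((s + r : ℝ) : ℂ))))
      rw [mul_left_comm, ← Complex.exp_add, show z * s + -(z * ((s + r : ℝ) : ℂ)) = -(z * r) by
        push_cast; ring]
    have h3 : laplaceShift F s z = Complex.exp (z * s) * twoSided F z -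
        ∫ r in Iic (0 : ℝ), F (s + r) * Complex.exp (-(z * r)) := by
      rw [← h2, ← h1, add_sub_cancel_left, laplaceShift]
    rw [h3]
    refine (norm_sub_le _ _).trans (add_le_add ?_ (hset _ measurableSet_Iic fun r hr =>
      mul_nonneg_of_nonpos_of_nonpos h0 hr))
    rw [norm_mul, Complex.norm_exp]
    refine (mul_le_of_le_one_left (norm_nonneg _) (Real.exp_le_one_iff.2 ?_)).trans (hG h0)
    simpa using mul_nonpos_of_nonpos_of_nonneg h0 hs
  · exact (hset _ measurableSet_Ioi fun r hr => mul_nonneg h0 (le_of_lt hr)).trans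
      (le_add_of_nonneg_left hE)

theorem norm_exp_mul_sub_one_le {z : ℂ} (hz : z.re ≤ 0) {a : ℝ} (ha : 0 ≤ a) :
    ‖Complex.exp (z * a) - 1‖ ≤ 2 * (‖z‖ * a) := by
  have e : ‖z * a‖ = ‖z‖ * a := by rw [norm_mul, Complex.norm_real, Real.norm_of_nonneg ha]
  rcases le_total ‖z * a‖ 1 with h | h
  · exact (Complex.norm_exp_sub_one_le h).trans_eq (by rw [e])
  · have h1 : ‖Complex.exp (z * a)‖ ≤ 1 := by
      rw [Complex.norm_exp, Real.exp_le_one_iff]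
      simpa using mul_nonpos_of_nonpos_of_nonneg hz ha
    calc ‖Complex.exp (z * a) - 1‖ ≤ ‖Complex.exp (z * a)‖ + ‖(1 : ℂ)‖ := norm_sub_le _ _
      _ ≤ 2 * 1 := by rw [norm_one]; linarith
      _ ≤ 2 * (‖z‖ * a) := by rw [← e]; gcongr

variable {U Λ : Set ℂ} {k : ℂ → ℝ}
  {R : ℂ → (ℂ × weightedAnalytic U k →L[ℂ] ℂ × weightedAnalytic U k)}

/-- An exponentially localised function gives rise to an element of the semigroup's space. -/
theorem exists_orbit (hU : IsOpen U) (hk : ContinuousOn k U) {k₀ : ℝ} (hk₀ : 0 < k₀)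
    (hk0 : ∀ z ∈ U, k₀ ≤ k z) (hΛ : Λ ⊆ U) (hR1 : ∀ a ∈ Λ, ∀ x, (R a x).1 = evalAt U k a x.2)
    (hR2 : ∀ a ∈ Λ, ∀ x, ∀ w ∈ U, w ≠ a →
      evalAt U k w (R a x).2 = (evalAt U k a x.2 - evalAt U k w x.2) / (w - a))
    (hκ : 0 < κ) (hUκ : ∀ z ∈ U, -κ < z.re) (hF : Continuous F)
    (hb : ∀ s, ‖F s‖ ≤ B * Real.exp (-(κ * |s - t|))) {B' C C' : ℝ} (hC : 0 ≤ C) (hC' : 0 ≤ C')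
    (hlip : ∀ s a, 0 ≤ a → a ≤ 1 → ‖F (s + a) - F s‖ ≤ B' * a * Real.exp (-(κ * |s - t|)))
    (hG : ∀ z ∈ U, z.re ≤ 0 → ‖twoSided F z‖ ≤ C * k z)
    (hG' : ∀ z ∈ U, z.re ≤ 0 → ‖z‖ * ‖twoSided F z‖ ≤ C' * k z) :
    ∃ g : mildSolutions Λ R, ‖g‖ ≤ C + B * (2 / κ) / k₀ + B ∧ ∀ s : ℝ≥0, ∀ z ∈ U,
      evalAt U k z ((g : ℝ≥0 →ᵇ ℂ × weightedAnalytic U k) s).2 = laplaceShift F s z := by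
  have hB : 0 ≤ B :=
    nonneg_of_mul_nonneg_left ((norm_nonneg _).trans (hb 0)) (Real.exp_pos _)
  have hB' : 0 ≤ B' := by
    have := (norm_nonneg _).trans (hlip 0 1 zero_le_one le_rfl)
    rw [mul_one] at this
    exact nonneg_of_mul_nonneg_left this (Real.exp_pos _)
  have hexp : ∀ s, Real.exp (-(κ * |s - t|)) ≤ 1 := fun s =>
    Real.exp_le_one_iff.2 (neg_nonpos.2 (by positivity))
  have hk1 : ∀ x, 0 ≤ x → ∀ z ∈ U, x ≤ x / k₀ * k z := fun x hx z hz => by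
    rw [div_mul_eq_mul_div, le_div_iff₀ hk₀]
    exact mul_le_mul_of_nonneg_left (hk0 z hz) hx
  have hfb : ∀ s, ‖F s‖ ≤ C + B * (2 / κ) / k₀ + B := fun s => by
    refine (hb s).trans ((mul_le_of_le_one_right hB (hexp s)).trans ?_)
    have : 0 ≤ B * (2 / κ) / k₀ := by positivity
    linarith
  have hub : ∀ s, 0 ≤ s → ∀ z ∈ U,
      ‖laplaceShift F s z‖ ≤ (C + B * (2 / κ) / k₀ + B) * k z := fun s hs z hz => by
    have hkz : 0 < k z := hk₀.trans_le (hk0 z hz)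
    have h1 := norm_laplaceShift_le hκ hF hb hs (hUκ z hz) (E := C * k z) (by positivity)
      (hG z hz)
    have h2 := hk1 (B * (2 / κ)) (by positivity) z hz
    have h3 : 0 ≤ B * k z := by positivity
    linarith
  -- The Lipschitz constants built from B' and C' serve only uniform continuity. They do not enter
  -- the bound for the norm of g, so they may depend on the pulse.
  have hfc : ∀ s a, 0 ≤ a → a ≤ 1 →
      ‖F (s + a) - F s‖ ≤ (2 * C' + B' * (2 / κ) / k₀ + B') * a := fun s a ha ha1 => by
    refine (hlip s a ha ha1).trans ((mul_le_of_le_one_right (by positivity) (hexp s)).trans ?_)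
    gcongr
    have : 0 ≤ B' * (2 / κ) / k₀ := by positivity
    linarith
  have huc : ∀ s a, 0 ≤ s → 0 ≤ a → a ≤ 1 → ∀ z ∈ U, ‖laplaceShift F (s + a) z -
      laplaceShift F s z‖ ≤ (2 * C' + B' * (2 / κ) / k₀ + B') * a * k z := fun s a hs ha ha1 z hz => by
    have hkz : 0 < k z := hk₀.trans_le (hk0 z hz)
    -- The norm bound is applied to F(· + a) - F. Its two-sided transform is (e^{za} - 1) times that
    -- of F, and `hG'` pays for the resulting factor |z| a.
    have hFa : Continuous fun r => F (r + a) - F r := by fun_prop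
    have hzκ := hUκ z hz
    have h1 : laplaceShift (fun r => F (r + a) - F r) s z =
        laplaceShift F (s + a) z - laplaceShift F s z := by
      rw [laplaceShift, laplaceShift, laplaceShift, ← integral_sub
        (integrableOn_laplaceShift hκ hF hb (s + a) hzκ)
        (integrableOn_laplaceShift hκ hF hb s hzκ)]
      refine integral_congr_ae (Eventually.of_forall fun r => ?_)
      simp only [add_right_comm s a r, sub_mul]
    have h2 : z.re ≤ 0 → ‖twoSided (fun r => F (r + a) - F r) z‖ ≤ 2 * C' * a * k z := by
      intro h0
      have hzκ' : |z.re| < κ := by rw [abs_of_nonpos h0]; linarith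
      have hi := integrable_mul_exp_of_localised hF hb hzκ'
      have e : ∀ r : ℝ, F (r + a) * Complex.exp (-(z * r)) = Complex.exp (z * a) *
          (F (r + a) * Complex.exp (-(z * ((r + a : ℝ) : ℂ)))) := fun r => by
        rw [mul_left_comm, ← Complex.exp_add]
        congr 2
        push_cast
        ring
      have hia : Integrable fun r : ℝ => F (r + a) * Complex.exp (-(z * r)) := by
        simp only [e]
        exact (hi.comp_add_right a).const_mul _
      have h3 : twoSided (fun r => F (r + a) - F r) z =
          (Complex.exp (z * a) - 1) * twoSided F z := by
        simp only [twoSided, sub_mul]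
        rw [integral_sub hia hi, one_mul]
        congr 1
        simp only [e]
        rw [integral_const_mul, integral_add_right_eq_self
          (fun r : ℝ => F r * Complex.exp (-(z * r))) a]
      rw [h3, norm_mul]
      calc ‖Complex.exp (z * a) - 1‖ * ‖twoSided F z‖
          ≤ 2 * (‖z‖ * a) * ‖twoSided F z‖ := by
            gcongr
            exact norm_exp_mul_sub_one_le h0 ha
        _ = 2 * a * (‖z‖ * ‖twoSided F z‖) := by ring
        _ ≤ 2 * a * (C' * k z) := mul_le_mul_of_nonneg_left (hG' z hz h0) (by positivity)
        _ = 2 * C' * a * k z := by ring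
    have h4 := norm_laplaceShift_le hκ hFa (B := B' * a) (t := t)
      (fun s => hlip s a ha ha1) hs hzκ (E := 2 * C' * a * k z) (by positivity) h2
    rw [h1] at h4
    have h5 := hk1 (B' * a * (2 / κ)) (by positivity) z hz
    have h6 : 0 ≤ B' * a * k z := by positivity
    have h7 : B' * a * (2 / κ) / k₀ * k z = B' * (2 / κ) / k₀ * a * k z := by ring
    calc _ ≤ _ := h4
      _ ≤ 2 * C' * a * k z + B' * (2 / κ) / k₀ * a * k z + B' * a * k z := by linarith
      _ = _ := by ring
  obtain ⟨g, hg, hg'⟩ := exists_mildSolution (R := R) hU hk (fun z hz => hk₀.trans_le (hk0 z hz))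
    hΛ hR1 hR2 (by positivity) (by positivity) hfb
    (fun s => (differentiableOn_laplaceShift hκ hF hb s).mono hUκ) hub hfc huc
    (fun s h _ hh z hz => laplaceShift_sub hκ hF hb s hh (hUκ z hz))
  exact ⟨g, hg, fun s => (hg' s).2⟩

end Localised

end SemigroupDecay

namespace SemigroupDecay

open MeasureTheory

/-! ### Test functions built from the Gamma function -/

/-- A pulse at time `t` of frequency `ω`; its two-sided Laplace transform decays doubly
exponentially towards low frequencies. -/
def pulse (β σ ω t s : ℝ) : ℂ :=
  σ * Complex.exp (ω * (s - t) * Complex.I) *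
    Complex.Gamma (σ + ((t - s) / β : ℝ) * Complex.I)

variable {β σ ω t : ℝ}

theorem continuous_pulse (hσ : 0 < σ) : Continuous (pulse β σ ω t) := by
  have h := (continuous_Gamma_vertical hσ).comp (show Continuous fun s : ℝ => (t - s) / β by fun_prop)
  unfold pulse
  exact (by fun_prop : Continuous fun s : ℝ =>
    (σ : ℂ) * Complex.exp (ω * (s - t) * Complex.I)).mul h

theorem half_le_cos_one : (1 : ℝ) / 2 ≤ Real.cos 1 := by
  have := Real.one_sub_sq_div_two_le_cos (x := 1)
  linarith

theorem norm_exp_mul_sub_mul_I (ω s t : ℝ) :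
    ‖Complex.exp (ω * (s - t) * Complex.I)‖ = 1 := by
  have := Complex.norm_exp_ofReal_mul_I (ω * (s - t))
  push_cast at this
  exact this

/-- The factor σ cancels the pole of Γ at 0: σΓ(σ) = Γ(1+σ) ≤ 1, by convexity of Γ and Γ(1) = Γ(2) =
1. Hence the constant 2 is uniform in σ. -/
theorem norm_pulse_le (hβ : 0 < β) (hσ : 0 < σ) (hσ1 : σ ≤ 1) (s : ℝ) :
    ‖pulse β σ ω t s‖ ≤ 2 * Real.exp (-(1 / β * |s - t|)) := by
  have h1 := norm_Gamma_le (a := σ + ((t - s) / β : ℝ) * Complex.I) (by simpa using hσ)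
  have h2 : (σ + ((t - s) / β : ℝ) * Complex.I : ℂ).im = (t - s) / β := by simp
  have h3 : (σ + ((t - s) / β : ℝ) * Complex.I : ℂ).re = σ := by simp
  rw [h2, h3, abs_div, abs_of_pos hβ, abs_sub_comm,
      show |s - t| / β = 1 / β * |s - t| by ring] at h1
  have hc := Real.cos_one_pos
  have h4 : (1 / Real.cos 1) ^ σ ≤ 2 := by
    calc (1 / Real.cos 1) ^ σ ≤ (1 / Real.cos 1) ^ (1 : ℝ) :=
        Real.rpow_le_rpow_of_exponent_le (by rw [le_div_iff₀ hc]; linarith [Real.cos_le_one 1]) hσ1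
      _ = 1 / Real.cos 1 := Real.rpow_one _
      _ ≤ 2 := by rw [div_le_iff₀ hc]; linarith [half_le_cos_one]
  have h5 : σ * Real.Gamma σ ≤ 1 := by
    rw [← Real.Gamma_add_one hσ.ne']
    have := Real.convexOn_Gamma.2 (show (1 : ℝ) ∈ Ioi 0 by simp) (show (2 : ℝ) ∈ Ioi 0 by simp)
      (show 0 ≤ 1 - σ by linarith) hσ.le (by ring)
    simp only [smul_eq_mul, Real.Gamma_one, Real.Gamma_two] at this
    rw [show (1 - σ) * 1 + σ * 2 = σ + 1 by ring] at this
    linarith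
  have hG := Real.Gamma_pos_of_pos hσ
  rw [pulse, norm_mul, norm_mul, norm_exp_mul_sub_mul_I, mul_one, Complex.norm_real,
    Real.norm_of_nonneg hσ.le]
  calc σ * ‖Complex.Gamma (σ + ((t - s) / β : ℝ) * Complex.I)‖
      ≤ σ * (Real.exp (-(1 / β * |s - t|)) * ((1 / Real.cos 1) ^ σ * Real.Gamma σ)) := by gcongr
    _ = (1 / Real.cos 1) ^ σ * (σ * Real.Gamma σ) * Real.exp (-(1 / β * |s - t|)) := by ring
    _ ≤ 2 * 1 * Real.exp (-(1 / β * |s - t|)) := by gcongr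
    _ = _ := by ring

/-- Exponential decay of the derivative of the Gamma function on vertical lines. -/
theorem exists_norm_deriv_Gamma_le (hσ : 0 < σ) :
    ∃ D : ℝ, 0 ≤ D ∧ ∀ y : ℝ,
      ‖deriv Complex.Gamma (σ + y * Complex.I)‖ ≤ D * Real.exp (-|y|) := by
  have hcont : ContinuousOn (fun x : ℝ => (1 / Real.cos 1) ^ x * Real.Gamma x)
      (Icc (σ / 2) (3 * σ / 2)) := by
    intro x hx
    have hx0 : 0 < x := by linarith [hx.1]
    refine ContinuousAt.continuousWithinAt (ContinuousAt.mul ?_ ?_)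
    · exact Real.continuousAt_const_rpow (one_div_pos.2 Real.cos_one_pos).ne'
    · exact (Real.differentiableAt_Gamma fun m h => by
        have hm : (0 : ℝ) ≤ m := m.cast_nonneg
        linarith).continuousAt
  obtain ⟨A, hA⟩ := isCompact_Icc.exists_bound_of_continuousOn hcont
  have hA0 : 0 ≤ A := (norm_nonneg _).trans (hA (σ / 2) ⟨le_rfl, by linarith⟩)
  refine ⟨Real.exp (σ / 2) * A / (σ / 2), by positivity, fun y => ?_⟩
  have hre : ∀ z ∈ Metric.closedBall (σ + y * Complex.I : ℂ) (σ / 2),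
      |z.re - σ| ≤ σ / 2 ∧ |z.im - y| ≤ σ / 2 := fun z hz => by
    rw [mem_closedBall_iff_norm] at hz
    constructor
    · refine le_trans ?_ hz
      simpa using Complex.abs_re_le_norm (z - (σ + y * Complex.I))
    · refine le_trans ?_ hz
      simpa using Complex.abs_im_le_norm (z - (σ + y * Complex.I))
  have hpos : ∀ z ∈ Metric.closedBall (σ + y * Complex.I : ℂ) (σ / 2), 0 < z.re := fun z hz => by
    have := (abs_le.1 (hre z hz).1).1
    linarith
  -- Cauchy's estimate on a disc of radius σ/2, which stays in Re z ≥ σ/2 > 0.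
  have h1 := Complex.norm_deriv_le_of_forall_mem_sphere_norm_le (f := Complex.Gamma)
    (c := σ + y * Complex.I) (R := σ / 2) (C := Real.exp (σ / 2) * A * Real.exp (-|y|))
    (by linarith) ?_ fun z hz => ?_
  · refine h1.trans_eq ?_
    ring
  · refine DifferentiableOn.diffContOnCl ?_
    rw [closure_ball _ (by linarith : σ / 2 ≠ 0)]
    intro z hz
    exact (Complex.differentiableAt_Gamma z fun m h => by
      have h2 := hpos z hz
      rw [h, Complex.neg_re, Complex.natCast_re] at h2
      have hm : (0 : ℝ) ≤ m := m.cast_nonneg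
      linarith).differentiableWithinAt
  · have hz' := Metric.sphere_subset_closedBall hz
    have h2 := abs_le.1 (hre z hz').1
    have h3 := hA z.re ⟨by linarith [h2.1], by linarith [h2.2]⟩
    have h4 : |y| ≤ |z.im| + σ / 2 := by
      have := abs_sub_abs_le_abs_sub y z.im
      rw [abs_sub_comm] at this
      linarith [(hre z hz').2]
    calc ‖Complex.Gamma z‖ ≤ Real.exp (-|z.im|) * ((1 / Real.cos 1) ^ z.re * Real.Gamma z.re) :=
          norm_Gamma_le (hpos z hz')
      _ ≤ Real.exp (σ / 2 + -|y|) * A :=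
          mul_le_mul (Real.exp_le_exp.2 (by linarith)) ((le_abs_self _).trans h3)
            (mul_nonneg (Real.rpow_nonneg (one_div_pos.2 Real.cos_one_pos).le _)
              (Real.Gamma_pos_of_pos (hpos z hz')).le) (Real.exp_pos _).le
      _ = Real.exp (σ / 2) * A * Real.exp (-|y|) := by rw [Real.exp_add]; ring

theorem exists_lipschitz_pulse (hβ : 0 < β) (hσ : 0 < σ) (hσ1 : σ ≤ 1) :
    ∃ B' : ℝ, ∀ s a, 0 ≤ a → a ≤ 1 →
      ‖pulse β σ ω t (s + a) - pulse β σ ω t s‖ ≤ B' * a * Real.exp (-(1 / β * |s - t|)) := by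
  obtain ⟨D, hD0, hD⟩ := exists_norm_deriv_Gamma_le hσ
  set D' : ℝ := 2 * |ω| + σ * D / β with hD'
  have hD'0 : 0 ≤ D' := by positivity
  have hderiv : ∀ s : ℝ, ∃ d : ℂ, HasDerivAt (pulse β σ ω t) d s ∧
      ‖d‖ ≤ D' * Real.exp (-(1 / β * |s - t|)) := fun s => by
    have h1 : HasDerivAt (fun s : ℝ => (σ : ℂ) * Complex.exp (ω * (s - t) * Complex.I))
        (σ * (Complex.exp (ω * (s - t) * Complex.I) * (ω * Complex.I))) s := by
      have h := (((((hasDerivAt_id (s : ℂ)).sub_const (t : ℂ)).const_mul (ω : ℂ)).mul_const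
        Complex.I).cexp.const_mul (σ : ℂ)).comp_ofReal
      simpa using h
    have h2 : HasDerivAt (fun s : ℝ => (σ + ((t - s) / β : ℝ) * Complex.I : ℂ))
        (-(1 / β : ℝ) * Complex.I) s := by
      have h3 : HasDerivAt (fun s : ℝ => (t - s) / β) (-(1 / β)) s := by
        have := ((hasDerivAt_id s).const_sub t).div_const β
        simpa [neg_div] using this
      have := (h3.ofReal_comp.mul_const Complex.I).const_add (σ : ℂ)
      simpa using this
    have hG : HasDerivAt Complex.Gamma (deriv Complex.Gamma (σ + ((t - s) / β : ℝ) * Complex.I))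
        (σ + ((t - s) / β : ℝ) * Complex.I) :=
      (Complex.differentiableAt_Gamma _ fun m h => by
        have := congrArg Complex.re h
        simp at this
        have hm : (0 : ℝ) ≤ m := m.cast_nonneg
        linarith).hasDerivAt
    have h4 := h1.mul (hG.comp s h2)
    refine ⟨_, h4, (norm_add_le _ _).trans ?_⟩
    have h5 : σ * (Complex.exp (ω * (s - t) * Complex.I) * (ω * Complex.I)) *
        Complex.Gamma (σ + ((t - s) / β : ℝ) * Complex.I) =
        ω * Complex.I * pulse β σ ω t s := by
      rw [pulse]; ring
    have h6 := norm_pulse_le (ω := ω) (t := t) hβ hσ hσ1 s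
    have h7 := hD ((t - s) / β)
    rw [abs_div, abs_of_pos hβ, abs_sub_comm,
      show |s - t| / β = 1 / β * |s - t| by ring] at h7
    rw [hD', add_mul]
    refine add_le_add ?_ ?_
    · change ‖σ * (Complex.exp (ω * (s - t) * Complex.I) * (ω * Complex.I)) *
        Complex.Gamma (σ + ((t - s) / β : ℝ) * Complex.I)‖ ≤ _
      rw [h5, norm_mul, norm_mul, Complex.norm_I, mul_one, Complex.norm_real, Real.norm_eq_abs]
      calc |ω| * ‖pulse β σ ω t s‖ ≤ |ω| * (2 * Real.exp (-(1 / β * |s - t|))) := by gcongr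
        _ = _ := by ring
    · rw [norm_mul, norm_mul, norm_mul, norm_mul, norm_exp_mul_sub_mul_I, Complex.norm_I, mul_one,
        mul_one, norm_neg, Complex.norm_real, Complex.norm_real, Real.norm_of_nonneg hσ.le,
        Real.norm_of_nonneg (one_div_pos.2 hβ).le]
      calc σ * (‖deriv Complex.Gamma (σ + ((t - s) / β : ℝ) * Complex.I)‖ * (1 / β))
          ≤ σ * (D * Real.exp (-(1 / β * |s - t|)) * (1 / β)) := by gcongr
        _ = _ := by ring
  choose d hd hdn using hderiv
  -- The factor exp(1/β) is the cost of replacing |x - t| by |s - t| for x in [s, s+1].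
  refine ⟨D' * Real.exp (1 / β), fun s a ha ha1 => ?_⟩
  have h1 := norm_image_sub_le_of_norm_deriv_le_segment' (f := pulse β σ ω t) (f' := d)
    (a := s) (b := s + a) (C := D' * Real.exp (1 / β) * Real.exp (-(1 / β * |s - t|)))
    (fun x _ => (hd x).hasDerivWithinAt) (fun x hx => ?_) (s + a) ⟨by linarith, le_rfl⟩
  · refine h1.trans_eq ?_
    ring
  · refine (hdn x).trans ?_
    rw [mul_assoc, ← Real.exp_add]
    have h2 : |s - t| ≤ |x - t| + 1 := by
      have h3 : |s - t| ≤ |s - x| + |x - t| := abs_sub_le _ _ _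
      have h4 : |s - x| ≤ 1 := by
        rw [abs_sub_comm, abs_of_nonneg (by linarith [hx.1])]
        linarith [hx.2]
      linarith
    have h3 : 1 / β * |s - t| ≤ 1 / β * (|x - t| + 1) := by gcongr
    gcongr
    linarith

/-- The substitution r = t - βy turns the transform into the Mellin inversion integral at w = β(ω +
iz), and Im w = β Re z. -/
theorem twoSided_pulse (hβ : 0 < β) (hσ : 0 < σ) {z : ℂ} (hz : |β * z.re| < 1) :
    twoSided (pulse β σ ω t) z = 2 * Real.pi * β * σ * Complex.exp (-(z * t)) *
      Complex.exp (σ * (β * ω + β * z * Complex.I)) *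
      Complex.exp (-Complex.exp (β * ω + β * z * Complex.I)) := by
  set w : ℂ := β * ω + β * z * Complex.I with hw
  have hwim : |w.im| < 1 := by
    have : w.im = β * z.re := by simp [hw]
    rwa [this]
  have hβ' : (β : ℂ) ≠ 0 := Complex.ofReal_ne_zero.2 hβ.ne'
  have h1 := integral_exp_mul_Gamma hσ hwim
  have h2 : ∀ y : ℝ, pulse β σ ω t (t - β * y) * Complex.exp (-(z * ((t - β * y : ℝ) : ℂ))) =
      σ * Complex.exp (-(z * t)) * Complex.exp (σ * w) *
      (Complex.exp (-((σ + y * Complex.I) * w)) * Complex.Gamma (σ + y * Complex.I)) := fun y => by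
    have e1 : (t - (t - β * y)) / β = y := by field_simp; ring
    rw [pulse, e1]
    have e2 : Complex.exp (ω * (((t - β * y : ℝ) : ℂ) - t) * Complex.I) *
        Complex.exp (-(z * ((t - β * y : ℝ) : ℂ))) = Complex.exp (-(z * t)) * Complex.exp (σ * w) *
        Complex.exp (-((σ + y * Complex.I) * w)) := by
      rw [← Complex.exp_add, ← Complex.exp_add, ← Complex.exp_add]
      congr 1
      rw [hw]
      push_cast
      linear_combination (β * y * z) * Complex.I_sq
    linear_combination (σ * Complex.Gamma (σ + y * Complex.I)) * e2
  have h3 : ∫ y : ℝ, pulse β σ ω t (t - β * y) * Complex.exp (-(z * ((t - β * y : ℝ) : ℂ))) =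
      (β⁻¹ : ℝ) • twoSided (pulse β σ ω t) z := by
    rw [twoSided, ← integral_sub_left_eq_self (fun r : ℝ => pulse β σ ω t r *
      Complex.exp (-(z * r))) volume t]
    have := Measure.integral_comp_mul_left (fun r : ℝ => pulse β σ ω t (t - r) *
      Complex.exp (-(z * ((t - r : ℝ) : ℂ)))) β
    rw [abs_of_pos (inv_pos.2 hβ)] at this
    exact this
  simp only [h2] at h3
  rw [integral_const_mul, h1, Complex.real_smul, Complex.ofReal_inv, eq_inv_mul_iff_mul_eq₀ hβ'] at h3
  rw [← h3]
  ring

theorem norm_twoSided_pulse (hβ : 0 < β) (hσ : 0 < σ) {z : ℂ} (hz : |β * z.re| < 1) :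
    ‖twoSided (pulse β σ ω t) z‖ = 2 * Real.pi * β * σ * Real.exp (-(z.re * t) +
      σ * (β * ω - β * z.im) - Real.exp (β * ω - β * z.im) * Real.cos (β * z.re)) := by
  have h1 : (β * ω + β * z * Complex.I : ℂ).re = β * ω - β * z.im := by
    simp
    ring
  have h2 : (β * ω + β * z * Complex.I : ℂ).im = β * z.re := by simp
  rw [twoSided_pulse hβ hσ hz]
  simp only [norm_mul, Complex.norm_exp, Complex.norm_real, Complex.norm_ofNat, Complex.neg_re,
    Complex.exp_re, Complex.re_ofReal_mul, h1, h2, Complex.re_mul_ofReal,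
    Real.norm_of_nonneg Real.pi_pos.le, Real.norm_of_nonneg hβ.le, Real.norm_of_nonneg hσ.le]
  rw [sub_eq_add_neg (-(z.re * t) + _), Real.exp_add, Real.exp_add]
  ring

/-- Near its centre the pulse is close to `1`, so that its integral is bounded below. -/
theorem exists_le_norm_integral_pulse : ∃ ρ : ℝ, 0 < ρ ∧ ∀ β σ ω t h : ℝ, 0 < β → 0 < σ → 0 ≤ h →
    |ω| * h ≤ ρ → h ≤ ρ * (β * σ) → σ ≤ ρ → h ≤ ρ * β →
    h / 2 ≤ ‖∫ r in (0 : ℝ)..h, pulse β σ ω t (t + r)‖ := by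
  -- Writing Γ(a) = Γ(1+a)/a removes the pole: the pulse at t + r is Ψ(ωr, σ, r/β, r/(βσ)), with Ψ
  -- continuous at the origin and equal to 1 there. This makes ρ independent of all parameters.
  set Ψ : ℝ × ℝ × ℝ × ℝ → ℂ := fun p => Complex.exp (p.1 * Complex.I) *
    Complex.Gamma (1 + (p.2.1 + -p.2.2.1 * Complex.I)) / (1 - p.2.2.2 * Complex.I) with hΨ
  have hΨc : ContinuousAt Ψ 0 := by
    have h1 : ContinuousAt Complex.Gamma
        (1 + (((0 : ℝ × ℝ × ℝ × ℝ).2.1 : ℂ) + -((0 : ℝ × ℝ × ℝ × ℝ).2.2.1 : ℂ) * Complex.I)) := by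
      simp only [Prod.snd_zero, Prod.fst_zero, Complex.ofReal_zero, neg_zero, zero_mul, add_zero]
      exact (Complex.differentiableAt_Gamma 1 fun m h => by
        have := congrArg Complex.re h
        simp at this
        have hm : (0 : ℝ) ≤ m := m.cast_nonneg
        linarith).continuousAt
    refine ContinuousAt.div (ContinuousAt.mul (by fun_prop) ?_) (by fun_prop) (by simp)
    exact ContinuousAt.comp (f := fun p : ℝ × ℝ × ℝ × ℝ =>
      (1 + (p.2.1 + -p.2.2.1 * Complex.I) : ℂ)) h1 (by fun_prop)
  have hΨ0 : Ψ 0 = 1 := by simp [hΨ]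
  obtain ⟨ρ, hρ, hΨρ⟩ := Metric.continuousAt_iff.1 hΨc (1 / 2) (by norm_num)
  refine ⟨ρ / 2, by positivity, fun β σ ω t h hβ hσ hh h1 h2 h3 h4 => ?_⟩
  have hval : ∀ r : ℝ, pulse β σ ω t (t + r) = Ψ (ω * r, σ, r / β, r / (β * σ)) := fun r => by
    have hβ' : (β : ℂ) ≠ 0 := Complex.ofReal_ne_zero.2 hβ.ne'
    have hσ' : (σ : ℂ) ≠ 0 := Complex.ofReal_ne_zero.2 hσ.ne'
    set a : ℂ := σ + -((r / β : ℝ) : ℂ) * Complex.I with ha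
    have ha0 : a ≠ 0 := fun e => by
      have := congrArg Complex.re e
      simp [ha] at this
      exact hσ.ne' this
    have e1 : (1 - ((r / (β * σ) : ℝ) : ℂ) * Complex.I) = a / σ := by
      rw [ha]
      push_cast
      field_simp
      ring
    have e2 : (σ + ((t - (t + r)) / β : ℝ) * Complex.I : ℂ) = a := by
      rw [ha]
      push_cast
      ring
    simp only [hΨ]
    rw [pulse, e2, e1, add_comm (1 : ℂ), Complex.Gamma_add_one a ha0]
    push_cast
    rw [add_sub_cancel_left]
    field_simp
  have hclose : ∀ r ∈ Icc 0 h, ‖pulse β σ ω t (t + r) - 1‖ ≤ 1 / 2 := fun r hr => by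
    rw [hval, ← hΨ0, ← dist_eq_norm]
    have b1 : |ω * r| ≤ ρ / 2 := by
      rw [abs_mul, abs_of_nonneg hr.1]
      exact (mul_le_mul_of_nonneg_left hr.2 (abs_nonneg _)).trans h1
    have b2 : |r / β| ≤ ρ / 2 := by
      rw [abs_of_nonneg (div_nonneg hr.1 hβ.le), div_le_iff₀ hβ]
      exact hr.2.trans h4
    have b3 : |r / (β * σ)| ≤ ρ / 2 := by
      rw [abs_of_nonneg (div_nonneg hr.1 (by positivity)), div_le_iff₀ (by positivity)]
      exact hr.2.trans h2
    refine (hΨρ ?_).le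
    rw [dist_zero_right]
    refine lt_of_le_of_lt ?_ (half_lt_self hρ)
    refine max_le b1 (max_le ?_ (max_le b2 b3))
    change |σ| ≤ _
    rwa [abs_of_pos hσ]
  have hc : Continuous fun r => pulse β σ ω t (t + r) :=
    (continuous_pulse hσ).comp (by fun_prop)
  have h5 := intervalIntegral.norm_integral_le_of_norm_le_const (a := 0) (b := h) (C := 1 / 2)
    (f := fun r => pulse β σ ω t (t + r) - 1) fun r hr => by
      rw [uIoc_of_le hh] at hr
      exact hclose r ⟨hr.1.le, hr.2⟩
  rw [intervalIntegral.integral_sub (hc.intervalIntegrable _ _) intervalIntegrable_const,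
    intervalIntegral.integral_const, sub_zero, abs_of_nonneg hh, Complex.real_smul, mul_one] at h5
  have h6 := norm_sub_norm_le (h : ℂ) (∫ r in (0 : ℝ)..h, pulse β σ ω t (t + r))
  rw [norm_sub_rev, Complex.norm_real, Real.norm_of_nonneg hh] at h6
  linarith

end SemigroupDecay

namespace SemigroupDecay

open MeasureTheory
open scoped NNReal BoundedContinuousFunction

/-! ### Regularly growing functions -/

section RegularGrowth

variable {M K : ℝ → ℝ}

theorem RegularlyGrowing.mono (hM : RegularlyGrowing M) {s r : ℝ} (hs : 0 ≤ s) (h : s ≤ r) :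
    M s ≤ M r := hM.monotoneOn hs (hs.trans h) h

/-- The logarithmic factor `log (1 + s) + log (1 + K(s))` in `M_K`. -/
def logFactor (K : ℝ → ℝ) (s : ℝ) : ℝ := Real.log (1 + s) + Real.log (1 + K s)

theorem logFactor_mono (hK : RegularlyGrowing K) {s r : ℝ} (hs : 0 ≤ s) (hsr : s ≤ r) :
    logFactor K s ≤ logFactor K r :=
  add_le_add (Real.log_le_log (by linarith) (by linarith))
    (Real.log_le_log (by linarith [hK.pos s hs])
      (by linarith [hK.mono hs hsr]))

theorem log_le_logFactor (hK : RegularlyGrowing K) {s : ℝ} (hs : 0 ≤ s) :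
    Real.log (1 + s) ≤ logFactor K s :=
  le_add_of_nonneg_right (Real.log_nonneg (by linarith [hK.pos s hs]))

theorem logFactor_pos (hK : RegularlyGrowing K) {s : ℝ} (hs : 0 ≤ s) : 0 < logFactor K s :=
  add_pos_of_nonneg_of_pos (Real.log_nonneg (by linarith))
    (Real.log_pos (by linarith [hK.pos s hs]))

theorem exp_logFactor (hK : RegularlyGrowing K) {s : ℝ} (hs : 0 ≤ s) :
    Real.exp (logFactor K s) = (1 + s) * (1 + K s) := by
  rw [logFactor, Real.exp_add, Real.exp_log (by linarith),
    Real.exp_log (by linarith [hK.pos s hs])]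

theorem continuousOn_MK (hM : RegularlyGrowing M) (hK : RegularlyGrowing K) :
    ContinuousOn (MK M K) (Ici 0) := by
  refine hM.continuousOn.mul (ContinuousOn.add ?_ ?_)
  · exact ContinuousOn.log (by fun_prop) fun s (hs : (0 : ℝ) ≤ s) => by positivity
  · exact ContinuousOn.log (continuousOn_const.add hK.continuousOn)
      fun s hs => by linarith [hK.pos s hs]

/-- There are arbitrarily large `R` to the left of which `M` drops at most exponentially. -/
theorem exists_large_exp_lower_bound (hM : RegularlyGrowing M) (hK : RegularlyGrowing K)
    {α β : ℝ} (hαβ : α < β) (hgrowth : MK M K =O[atTop] fun s : ℝ => Real.exp (α * s)) (N : ℝ) :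
    ∃ R, N ≤ R ∧ 0 ≤ R ∧ ∀ s, 0 ≤ s → s ≤ R → M R * Real.exp (-(β * (R - s))) ≤ M s := by
  set g : ℝ → ℝ := fun s => MK M K s * Real.exp (-(β * s)) with hg
  have hgc : ContinuousOn g (Ici 0) := (continuousOn_MK hM hK).mul (by fun_prop)
  have hgpos : ∀ s, 0 ≤ s → 0 < g s := fun s hs =>
    mul_pos (mul_pos (hM.pos s hs) (logFactor_pos hK hs)) (Real.exp_pos _)
  have hg0 : Tendsto g atTop (𝓝 0) := by
    have h1 : g =O[atTop] fun s : ℝ => Real.exp (α * s) * Real.exp (-(β * s)) :=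
      hgrowth.mul (isBigO_refl _ _)
    refine h1.trans_tendsto ?_
    have h2 : (fun s : ℝ => Real.exp (α * s) * Real.exp (-(β * s))) =
        fun s : ℝ => Real.exp (-((β - α) * s)) := by
      ext s
      rw [← Real.exp_add]
      congr 1
      ring
    rw [h2]
    exact Real.tendsto_exp_neg_atTop_nhds_zero.comp
      (tendsto_id.const_mul_atTop (sub_pos.2 hαβ))
  have hN0 : (0 : ℝ) ≤ max N 0 := le_max_right _ _
  obtain ⟨x, hx, hxmin⟩ := isCompact_Icc.exists_isMinOn (nonempty_Icc.2 hN0)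
    (hgc.mono Icc_subset_Ici_self)
  -- At s₁ the function g is below its minimum on [0, max N 0], so a minimiser over [0, s₁] lies at
  -- or beyond max N 0.
  obtain ⟨s₁, hs₁, hs₁N⟩ := ((hg0.eventually_lt_const (hgpos x hx.1)).and
    (eventually_ge_atTop (max N 0))).exists
  have hs0 : 0 ≤ s₁ := hN0.trans hs₁N
  obtain ⟨R, hR, hRmin⟩ := isCompact_Icc.exists_isMinOn (nonempty_Icc.2 hs0)
    (hgc.mono Icc_subset_Ici_self)
  have hRN : max N 0 ≤ R := by
    by_contra h
    have h1 : g x ≤ g R := hxmin ⟨hR.1, (not_le.1 h).le⟩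
    have h2 : g R ≤ g s₁ := hRmin ⟨hs0, le_rfl⟩
    linarith
  refine ⟨R, (le_max_left _ _).trans hRN, hR.1, fun s hs hsR => ?_⟩
  have h1 : g R ≤ g s := hRmin ⟨hs, hsR.trans hR.2⟩
  have hL := logFactor_pos hK hR.1
  -- Minimality compares M_K(s) e^{-βs} at R and s; monotonicity of the logarithmic factor then
  -- leaves a comparison of M alone.
  have h2 : M R * Real.exp (-(β * (R - s))) * logFactor K R ≤ M s * logFactor K R := by
    calc M R * Real.exp (-(β * (R - s))) * logFactor K R
        = M R * logFactor K R * Real.exp (-(β * R)) * Real.exp (β * s) := by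
          rw [show -(β * (R - s)) = -(β * R) + β * s by ring, Real.exp_add]
          ring
      _ ≤ M s * logFactor K s * Real.exp (-(β * s)) * Real.exp (β * s) :=
          mul_le_mul_of_nonneg_right h1 (Real.exp_pos _).le
      _ = M s * logFactor K s := by
          rw [mul_assoc, ← Real.exp_add, neg_add_cancel, Real.exp_zero, mul_one]
      _ ≤ M s * logFactor K R := by
          gcongr
          · exact (hM.pos s hs).le
          · exact logFactor_mono hK hs hsR
  exact le_of_mul_le_mul_right h2 hL

/-- Since M ≥ M(0) > 0, the growth bound on M_K passes to its logarithmic factor. This keeps the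
frequency ω of the pulse comparable to r. -/
theorem exists_log_logFactor_le (hM : RegularlyGrowing M) (hK : RegularlyGrowing K) {α : ℝ}
    (hgrowth : MK M K =O[atTop] fun s : ℝ => Real.exp (α * s)) :
    ∃ C : ℝ, ∀ᶠ s in atTop, Real.log (logFactor K s) ≤ α * s + C := by
  obtain ⟨C, hC, hb⟩ := hgrowth.exists_pos
  have hM0 := hM.pos 0 le_rfl
  refine ⟨Real.log (C / M 0), ?_⟩
  filter_upwards [hb.bound, eventually_ge_atTop (0 : ℝ)] with s hs hs0
  have hL := logFactor_pos hK hs0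
  have h1 : M 0 * logFactor K s ≤ C * Real.exp (α * s) := by
    calc M 0 * logFactor K s ≤ M s * logFactor K s := by
          gcongr
          exact hM.mono le_rfl hs0
      _ ≤ ‖MK M K s‖ := le_abs_self _
      _ ≤ C * ‖Real.exp (α * s)‖ := hs
      _ = C * Real.exp (α * s) := by rw [Real.norm_of_nonneg (Real.exp_pos _).le]
  have h2 : logFactor K s ≤ Real.exp (α * s) * (C / M 0) := by
    rw [← mul_div_assoc, le_div_iff₀ hM0]
    linarith
  calc Real.log (logFactor K s) ≤ Real.log (Real.exp (α * s) * (C / M 0)) :=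
        Real.log_le_log hL h2
    _ = α * s + Real.log (C / M 0) := by
        rw [Real.log_mul (Real.exp_pos _).ne' (by positivity), Real.log_exp]

theorem RegularlyGrowing.le_div (hM : RegularlyGrowing M) {c : ℝ} (hc : 0 < c)
    (hreg : ∀ s, 0 ≤ s → c * M (s + c / M s) ≤ M s) {s r : ℝ} (hs : 0 ≤ s) (hr : 0 ≤ r)
    (h : r ≤ s + c / M s) : c * M r ≤ M s := by
  refine le_trans ?_ (hreg s hs)
  gcongr
  exact hM.mono hr h

theorem isOpen_Omega (hM : RegularlyGrowing M) : IsOpen (Omega M) := by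
  have h1 : Continuous fun z : ℂ => M |z.im| :=
    hM.continuousOn.comp_continuous (by fun_prop) fun _ => mem_Ici.2 (abs_nonneg _)
  exact isOpen_lt (continuous_const.div h1 fun z => (hM.pos _ (abs_nonneg _)).ne')
    Complex.continuous_re

theorem RegularlyGrowing.const_mul (hM : RegularlyGrowing M) {a : ℝ} (ha : 1 ≤ a) :
    RegularlyGrowing fun s => a * M s := by
  have ha0 : 0 < a := one_pos.trans_le ha
  refine ⟨fun s hs => mul_pos ha0 (hM.pos s hs), fun s hs r hr h =>
    mul_le_mul_of_nonneg_left (hM.monotoneOn hs hr h) ha0.le,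
    continuousOn_const.mul hM.continuousOn, ?_⟩
  obtain ⟨c, hc0, hc1, hc⟩ := hM.regular
  refine ⟨c, hc0, hc1, fun s hs => ?_⟩
  have hMs := hM.pos s hs
  have h2 : c * M (s + c / (a * M s)) ≤ M s := by
    refine hM.le_div hc0 hc hs (by positivity) ?_
    gcongr
    nlinarith
  calc c * (a * M (s + c / (a * M s))) = a * (c * M (s + c / (a * M s))) := by ring
    _ ≤ a * M s := by gcongr

/-- As M ≥ M(0), the region lies in a half plane. For β ≤ a M(0), its part in Re z ≤ 0 satisfies |β
Re z| < 1, where the transform of the pulse converges. -/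
theorem neg_one_div_lt_re {a : ℝ} (ha : 0 < a) (hM : RegularlyGrowing M) {z : ℂ}
    (hz : z ∈ Omega fun s => a * M s) : -(1 / (a * M 0)) < z.re := by
  have h1 : -1 / (a * M |z.im|) < z.re := hz
  have h2 : M 0 ≤ M |z.im| := hM.mono le_rfl (abs_nonneg _)
  have h3 : 1 / (a * M |z.im|) ≤ 1 / (a * M 0) := by
    have := hM.pos 0 le_rfl
    gcongr
  rw [neg_div] at h1
  linarith

/-- Growth of `exp (-t Re z)` in the region, where `t = M(R) L`. -/
theorem neg_re_mul_le (hM : RegularlyGrowing M) {δ β R L : ℝ} (hδ : 0 < δ) (hβ : 0 < β)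
    (hL : 0 < L) (hR : 0 ≤ R)
    (hgood : ∀ s, 0 ≤ s → s ≤ R → M R * Real.exp (-(β * (R - s))) ≤ M s) {z : ℂ}
    (hz : z ∈ Omega fun s => δ * M s) :
    -(z.re * (M R * L)) ≤ L / δ * Real.exp (max 0 (β * (R - z.im))) := by
  have h1 : -1 / (δ * M |z.im|) < z.re := hz
  have hMz := hM.pos _ (abs_nonneg z.im)
  have hMR := hM.pos R hR
  set q := max 0 (β * (R - z.im)) with hq
  have h2 : M R ≤ M |z.im| * Real.exp q := by
    rcases le_total |z.im| R with h | h
    · have h3 := hgood _ (abs_nonneg z.im) h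
      have h4 : β * (R - |z.im|) ≤ q :=
        (mul_le_mul_of_nonneg_left (by linarith [le_abs_self z.im]) hβ.le).trans (le_max_right _ _)
      calc M R = M R * Real.exp (-(β * (R - |z.im|))) * Real.exp (β * (R - |z.im|)) := by
            rw [mul_assoc, ← Real.exp_add, neg_add_cancel, Real.exp_zero, mul_one]
        _ ≤ M |z.im| * Real.exp q := by gcongr
    · calc M R ≤ M |z.im| := hM.mono hR h
        _ ≤ M |z.im| * Real.exp q :=
          le_mul_of_one_le_right hMz.le (Real.one_le_exp (le_max_left _ _))
  have h3 : -z.re ≤ 1 / (δ * M |z.im|) := by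
    rw [neg_div] at h1
    linarith
  calc -(z.re * (M R * L)) = -z.re * (M R * L) := by ring
    _ ≤ 1 / (δ * M |z.im|) * (M R * L) := by gcongr
    _ ≤ 1 / (δ * M |z.im|) * (M |z.im| * Real.exp q * L) := by gcongr
    _ = L / δ * Real.exp q := by field_simp

/-- The two-sided Laplace transform of a suitable pulse at time `M_K(R)` is dominated by `K`. -/
theorem norm_twoSided_pulse_le (hM : RegularlyGrowing M) (hK : RegularlyGrowing K)
    {δ β R : ℝ} (hδ : 4 ≤ δ) (hβ : 0 < β) (hδβ : β ≤ δ * M 0) (hR : 1 ≤ R)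
    (hL : 1 ≤ logFactor K R) (hσ : 1 / (β * R) ≤ 1 / 8)
    (hlog : Real.log (logFactor K R) ≤ β * R)
    (hgood : ∀ s, 0 ≤ s → s ≤ R → M R * Real.exp (-(β * (R - s))) ≤ M s) {z : ℂ}
    (hz : z ∈ Omega fun s => δ * M s) (hz0 : z.re ≤ 0) :
    ‖twoSided (pulse β (1 / (β * R)) (R + Real.log (logFactor K R) / β) (MK M K R)) z‖ ≤
      4 * Real.pi * Real.exp 1 * (1 + 1 / K 0) * K |z.im| *
        Real.exp (-(1 / (β * R) * |β * (R - z.im)|)) := by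
  set L := logFactor K R with hLdef
  set σ := 1 / (β * R) with hσdef
  set q := β * (R - z.im) with hq
  have hR0 : 0 ≤ R := by linarith
  have hσ0 : 0 < σ := by positivity
  have hL0 : 0 < L := by linarith
  have hβR : β * R * σ = 1 := by rw [hσdef]; field_simp
  have hK0 := hK.pos 0 le_rfl
  have hKR := hK.pos R hR0
  have hKz := hK.pos _ (abs_nonneg z.im)
  have hKz0 : K 0 ≤ K |z.im| := hK.mono le_rfl (abs_nonneg _)
  have hre : |β * z.re| < 1 := by
    have h1 := neg_one_div_lt_re (by linarith) hM hz
    have h2 : 1 / (δ * M 0) ≤ 1 / β := by gcongr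
    rw [abs_of_nonpos (mul_nonpos_of_nonneg_of_nonpos hβ.le hz0)]
    have h3 : -z.re < 1 / β := by linarith
    rw [lt_div_iff₀ hβ] at h3
    linarith
  have hcos : 1 / 2 ≤ Real.cos (β * z.re) := by
    refine half_le_cos_one.trans ?_
    rw [← Real.cos_abs (β * z.re)]
    exact Real.cos_le_cos_of_nonneg_of_le_pi (abs_nonneg _) (by linarith [Real.pi_gt_three]) hre.le
  -- The shift (log L)/β of the frequency gives exp(Re w) = L e^q, with the same L as in the time
  -- M(R) L.
  have hw : β * (R + Real.log L / β) - β * z.im = Real.log L + q := by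
    rw [hq]
    field_simp
    ring
  have hexp : Real.exp (Real.log L + q) = L * Real.exp q := by
    rw [Real.exp_add, Real.exp_log hL0]
  have hσlog : σ * Real.log L ≤ 1 := by
    calc σ * Real.log L ≤ σ * (β * R) := by gcongr
      _ = 1 := by rw [mul_comm, hβR]
  have h1 := neg_re_mul_le hM (L := L) (by linarith : 0 < δ) hβ hL0 hR0 hgood hz
  rw [← hq] at h1
  have h2 : L / δ * Real.exp (max 0 q) ≤ L / 4 * Real.exp (max 0 q) := by gcongr
  have h3 : L * Real.exp q * (1 / 2) ≤ L * Real.exp q * Real.cos (β * z.re) := by gcongr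
  rw [norm_twoSided_pulse hβ hσ0 hre, hw, hexp]
  have hprod : MK M K R = M R * L := rfl
  rw [hprod]
  rcases le_total 0 q with h0 | h0
  -- Frequencies Im z ≤ R. Of the gain L e^q / 2 given by cos ≥ 1/2, one half absorbs e^{-zt}
  -- because δ ≥ 4; the other half absorbs 2σq, which turns e^{σq} into e^{-σq}.
  · rw [max_eq_right h0] at h1 h2
    have h4 : q ≤ Real.exp q := by linarith [Real.add_one_le_exp q]
    have h5 : 2 * (σ * q) ≤ L * Real.exp q / 4 := by
      have h6 : σ * q ≤ 1 / 8 * q := by gcongr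
      have h7 : 1 * Real.exp q ≤ L * Real.exp q := by gcongr
      linarith
    have h6 : -(z.re * (M R * L)) + σ * (Real.log L + q) -
        L * Real.exp q * Real.cos (β * z.re) ≤ 1 + -(σ * |q|) := by
      rw [abs_of_nonneg h0]
      linarith
    have h7 : (1 : ℝ) ≤ (1 + 1 / K 0) * K |z.im| := by
      rw [add_mul, one_mul, div_mul_eq_mul_div, one_mul]
      have : 1 ≤ K |z.im| / K 0 := by rwa [one_le_div hK0]
      linarith
    have h8 : β * σ ≤ 1 := by
      have : 0 < β * σ := by positivity
      nlinarith
    calc 2 * Real.pi * β * σ * Real.exp _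
        ≤ 2 * Real.pi * β * σ * Real.exp (1 + -(σ * |q|)) := by gcongr
      _ = 2 * Real.pi * Real.exp 1 * (β * σ) * 1 * Real.exp (-(σ * |q|)) := by
          rw [Real.exp_add]
          ring
      _ ≤ 4 * Real.pi * Real.exp 1 * 1 * ((1 + 1 / K 0) * K |z.im|) *
          Real.exp (-(σ * |q|)) := by
          gcongr
          norm_num
      _ = _ := by ring
  -- Frequencies Im z ≥ R. Here e^{-zt} costs at most e^L = (1+R)(1+K(R)); βσ = 1/R absorbs 1+R, and
  -- monotonicity of K absorbs the rest.
  · rw [max_eq_left h0, Real.exp_zero, mul_one] at h1 h2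
    have hRz : R ≤ z.im := by
      by_contra h
      have : 0 < q := mul_pos hβ (by linarith)
      linarith
    have hKRz : K R ≤ K |z.im| :=
      hK.mono hR0 (hRz.trans (le_abs_self _))
    have h6 : -(z.re * (M R * L)) + σ * (Real.log L + q) -
        L * Real.exp q * Real.cos (β * z.re) ≤ L + 1 + -(σ * |q|) := by
      rw [abs_of_nonpos h0]
      have : 0 < L * Real.exp q := by positivity
      linarith
    have h7 : 1 + K R ≤ (1 + 1 / K 0) * K |z.im| := by
      rw [add_mul, one_mul, div_mul_eq_mul_div, one_mul]
      have : 1 ≤ K |z.im| / K 0 := by rwa [one_le_div hK0]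
      linarith
    have h8 : β * σ * (1 + R) ≤ 2 := by
      have : 0 < β * σ := by positivity
      nlinarith
    calc 2 * Real.pi * β * σ * Real.exp _
        ≤ 2 * Real.pi * β * σ * Real.exp (L + 1 + -(σ * |q|)) := by gcongr
      _ = 2 * Real.pi * Real.exp 1 * (β * σ * (1 + R)) * (1 + K R) * Real.exp (-(σ * |q|)) := by
          rw [Real.exp_add, Real.exp_add, hLdef, exp_logFactor hK hR0]
          ring
      _ ≤ 2 * Real.pi * Real.exp 1 * 2 * ((1 + 1 / K 0) * K |z.im|) *
          Real.exp (-(σ * |q|)) := by gcongr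
      _ = _ := by ring

end RegularGrowth

end SemigroupDecay

namespace SemigroupDecay

open scoped NNReal BoundedContinuousFunction

/-! ### The semigroup -/

section Construction

variable {M K : ℝ → ℝ}

/-- The weight `z ↦ K(|Im z|)`. -/
def imWeight (K : ℝ → ℝ) (z : ℂ) : ℝ := K |z.im|

theorem continuous_imWeight (hK : RegularlyGrowing K) : Continuous (imWeight K) :=
  hK.continuousOn.comp_continuous (by fun_prop) fun _ => mem_Ici.2 (abs_nonneg _)

theorem imWeight_pos (hK : RegularlyGrowing K) (z : ℂ) : 0 < imWeight K z :=
  hK.pos _ (abs_nonneg _)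

theorem Omega_subset_Omega (hM : RegularlyGrowing M) {δ₀ δ : ℝ} (hδ₀ : 0 < δ₀) (hδ : δ₀ ≤ δ) :
    (Omega fun s => δ * M s) ⊆ Omega fun s => δ₀ * M s := fun z hz => by
  have h1 : -1 / (δ * M |z.im|) < z.re := hz
  have h2 := hM.pos _ (abs_nonneg z.im)
  change -1 / (δ₀ * M |z.im|) < z.re
  refine lt_of_le_of_lt ?_ h1
  rw [neg_div, neg_div, neg_le_neg_iff]
  gcongr

/-- For some larger `δ`, difference quotients at points of `Ω_{δ M}` are bounded on the space of
functions that are analytic on `Ω_{δ₀ M}`. -/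
theorem exists_norm_dslope_le (hM : RegularlyGrowing M) (hK : RegularlyGrowing K)
    (hMK : ∀ s : ℝ, 0 ≤ s → M s ≤ K s) {δ₀ : ℝ} (hδ₀ : 1 ≤ δ₀) :
    ∃ δ C : ℝ, δ₀ < δ ∧ 1 ≤ C ∧ ∀ a ∈ Omega (fun s => δ * M s), ∀ (h : ℂ → ℂ) (N : ℝ),
      DifferentiableOn ℂ h (Omega fun s => δ₀ * M s) → 0 ≤ N →
      (∀ z ∈ Omega (fun s => δ₀ * M s), ‖h z‖ ≤ N * imWeight K z) →
      ∀ w ∈ Omega (fun s => δ₀ * M s), ‖dslope h a w‖ ≤ C * imWeight K a * N * imWeight K w := by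
  obtain ⟨cM, hcM0, hcM1, hcM⟩ := hM.regular
  obtain ⟨cK, hcK0, hcK1, hcK⟩ := hK.regular
  have hδ₀0 : 0 < δ₀ := by linarith
  -- Both 1/(δ M(|Im a|)) and c/M(|Im a|) are at most c_M/(2δ₀ M(|Im a|)). Their sum is at most
  -- 1/(δ₀ M(|Im z|)) for z in the disc, which therefore stays in the larger region.
  set δ : ℝ := 2 * δ₀ / cM with hδ
  set c : ℝ := min cK (cM / (2 * δ₀)) with hc
  have hc0 : 0 < c := lt_min hcK0 (by positivity)
  have hcK' : c ≤ cK := min_le_left _ _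
  have hc1 : c ≤ 1 := hcK'.trans hcK1.le
  have hcM' : c ≤ cM / (2 * δ₀) := min_le_right _ _
  have hcM2 : c ≤ cM := hcM'.trans (div_le_self hcM0.le (by linarith))
  have hδδ₀ : δ₀ < δ := by
    rw [hδ, lt_div_iff₀ hcM0]
    nlinarith
  refine ⟨δ, 2 / c ^ 3, hδδ₀, ?_, fun a ha h N hh hN hb w hw => ?_⟩
  · rw [le_div_iff₀ (by positivity)]
    have : c ^ 3 ≤ 1 := pow_le_one₀ hc0.le hc1
    linarith
  have hMa := hM.pos _ (abs_nonneg a.im)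
  have him : ∀ z w : ℂ, |z.im| ≤ |w.im| + ‖z - w‖ := fun z w => by
    have h1 : |z.im| - |w.im| ≤ |z.im - w.im| := abs_sub_abs_le_abs_sub _ _
    have h2 : |z.im - w.im| ≤ ‖z - w‖ := Complex.abs_im_le_norm (z - w)
    linarith
  have hΛ : a ∈ Omega fun s => δ₀ * M s := Omega_subset_Omega hM hδ₀0 hδδ₀.le ha
  refine norm_dslope_le (isOpen_Omega (hM.const_mul hδ₀)) (fun z _ => imWeight_pos hK z) hc0 hc1
    (fun z _ w _ hzw => ?_) hΛ (fun z hz => ?_) hh hN hb hw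
  · have hKw := imWeight_pos hK w
    have h1 : cK * K |z.im| ≤ K |w.im| := by
      refine hK.le_div hcK0 hcK (abs_nonneg _) (abs_nonneg _) ((him z w).trans ?_)
      gcongr
      exact hzw.trans (by unfold imWeight at hKw ⊢; gcongr)
    refine le_trans ?_ h1
    exact mul_le_mul_of_nonneg_right hcK' (imWeight_pos hK z).le
  · rw [mem_closedBall_iff_norm] at hz
    -- Here M ≤ K enters: the radius c/K is at most c/M, the scale on which M is regular.
    have hMK' : M |a.im| ≤ imWeight K a := hMK _ (abs_nonneg _)
    have h1 : c / imWeight K a ≤ c / M |a.im| := by gcongr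
    have h2 : cM * M |z.im| ≤ M |a.im| := by
      refine hM.le_div hcM0 hcM (abs_nonneg _) (abs_nonneg _) ((him z a).trans ?_)
      gcongr
      exact hz.trans (h1.trans (by gcongr))
    have h3 : a.re - z.re ≤ c / M |a.im| := by
      have := Complex.abs_re_le_norm (z - a)
      rw [Complex.sub_re] at this
      have h4 := neg_le_abs (z.re - a.re)
      linarith
    have h4 : -1 / (δ * M |a.im|) < a.re := ha
    have hMz := hM.pos _ (abs_nonneg z.im)
    change -1 / (δ₀ * M |z.im|) < z.re
    have h5 : cM / (δ₀ * M |a.im|) ≤ 1 / (δ₀ * M |z.im|) := by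
      rw [div_le_div_iff₀ (by positivity) (by positivity)]
      nlinarith
    have h6 : 1 / (δ * M |a.im|) = cM / (2 * δ₀) / M |a.im| := by
      rw [hδ]
      field_simp
    have h7 : c / M |a.im| ≤ cM / (2 * δ₀) / M |a.im| := by gcongr
    have h8 : cM / (2 * δ₀) / M |a.im| + cM / (2 * δ₀) / M |a.im| = cM / (δ₀ * M |a.im|) := by
      field_simp
      ring
    rw [neg_div] at h4 ⊢
    linarith

theorem zero_mem_Omega (hM : RegularlyGrowing M) {δ : ℝ} (hδ : 0 < δ) :
    (0 : ℂ) ∈ Omega fun s => δ * M s := by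
  have := hM.pos 0 le_rfl
  change -1 / (δ * M |(0 : ℂ).im|) < (0 : ℂ).re
  rw [Complex.zero_im, abs_zero, Complex.zero_re, neg_div, neg_lt_zero]
  positivity

/-- Parameters `r` for which the pulse at time `M_K(r)` is admissible, and the lower bound for its
Laplace transforms at zero. -/
theorem exists_large_pulse (hM : RegularlyGrowing M) (hK : RegularlyGrowing K) {α β : ℝ}
    (hβ0 : 0 < β) (hαβ : α < β) (hβ : 2 * α ≤ β) (hα : 0 < α)
    (hgrowth : MK M K =O[atTop] fun s : ℝ => Real.exp (α * s)) :
    ∃ ρ : ℝ, 0 < ρ ∧ ∀ N : ℝ, ∃ r, N ≤ r ∧ 1 ≤ r ∧ 1 ≤ logFactor K r ∧ 1 / (β * r) ≤ 1 / 8 ∧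
      Real.log (logFactor K r) ≤ β * r ∧
      (∀ s, 0 ≤ s → s ≤ r → M r * Real.exp (-(β * (r - s))) ≤ M s) ∧ ∃ h : ℝ, 0 ≤ h ∧
      (ρ / 8 ≤ r * ‖laplaceShift (pulse β (1 / (β * r)) (r + Real.log (logFactor K r) / β)
        (MK M K r)) (MK M K r) 0‖ ∨
      ρ / 8 ≤ r * ‖laplaceShift (pulse β (1 / (β * r)) (r + Real.log (logFactor K r) / β)
        (MK M K r)) (MK M K r + h) 0‖) := by
  obtain ⟨ρ, hρ, hlow⟩ := exists_le_norm_integral_pulse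
  obtain ⟨C₁, hC₁⟩ := exists_log_logFactor_le hM hK hgrowth
  obtain ⟨N₁, hN₁⟩ := eventually_atTop.1 hC₁
  refine ⟨ρ, hρ, fun N => ?_⟩
  -- The thresholds: C₁/α gives log L ≤ 2αr ≤ βr, 2 gives L ≥ log 3 ≥ 1, 8/β gives σ ≤ 1/8, and
  -- 1/(βρ) gives σ ≤ ρ.
  obtain ⟨r, hrN, hr0, hgood⟩ := exists_large_exp_lower_bound hM hK hαβ hgrowth
    (max N (max N₁ (max (C₁ / α) (max 2 (max (8 / β) (1 / (β * ρ)))))))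
  simp only [max_le_iff] at hrN
  obtain ⟨hN, hrN₁, hrC, hr2, hr8, hrρ⟩ := hrN
  have hrpos : 0 < r := by linarith
  set L := logFactor K r with hL
  set σ : ℝ := 1 / (β * r) with hσ
  set ω : ℝ := r + Real.log L / β with hω
  set t : ℝ := MK M K r with ht
  have hσ0 : 0 < σ := by positivity
  have hβσ : β * σ = 1 / r := by rw [hσ]; field_simp
  rw [div_le_iff₀ hβ0] at hr8
  have hσ8 : σ ≤ 1 / 8 := by
    rw [hσ, div_le_div_iff₀ (by positivity) (by norm_num)]
    linarith
  have hσρ : σ ≤ ρ := by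
    rw [div_le_iff₀ (by positivity)] at hrρ
    rw [hσ, div_le_iff₀ (by positivity)]
    linarith
  have hL1 : 1 ≤ L := by
    refine le_trans ?_ (log_le_logFactor hK hr0)
    rw [Real.le_log_iff_exp_le (by linarith)]
    linarith [Real.exp_one_lt_three]
  have hlog : Real.log L ≤ β * r := by
    have h1 := hN₁ r hrN₁
    rw [div_le_iff₀ hα] at hrC
    nlinarith
  have hω0 : 0 ≤ ω := add_nonneg hr0 (div_nonneg (Real.log_nonneg hL1) hβ0.le)
  have hω2 : ω ≤ 2 * r := by
    have : Real.log L / β ≤ r := by rw [div_le_iff₀ hβ0]; linarith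
    linarith
  -- Since ω ≤ 2r and βσ = 1/r, this h satisfies both ωh ≤ ρ and h ≤ ρβσ.
  set h : ℝ := ρ / (2 * r) with hh
  have hh0 : 0 < h := by positivity
  refine ⟨r, hN, by linarith, hL1, hσ8, hlog, hgood, h, hh0.le, ?_⟩
  have h4 : ρ = 2 * (r * h) := by rw [hh]; field_simp
  have hint := hlow β σ ω t h hβ0 hσ0 hh0.le
    (by
      rw [abs_of_nonneg hω0]
      calc ω * h ≤ 2 * r * h := by gcongr
        _ = ρ := by rw [h4]; ring)
    (by
      rw [hβσ, hh, mul_one_div, div_le_div_iff₀ (by positivity) hrpos]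
      nlinarith) hσρ
    (by
      rw [hh, div_le_iff₀ (by positivity)]
      nlinarith)
  -- At z = 0 the values at t and t + h differ by the integral of the pulse, which is at least h/2
  -- in modulus, so one of them is at least h/4 = ρ/(8r).
  have hode := laplaceShift_sub (F := pulse β σ ω t) (z := 0) (one_div_pos.2 hβ0)
    (continuous_pulse hσ0) (norm_pulse_le hβ0 hσ0 (by linarith)) t hh0.le (by simpa using hβ0)
  simp only [zero_mul, zero_sub, intervalIntegral.integral_neg] at hode
  rw [← norm_neg, ← hode] at hint
  have h3 := hint.trans (norm_sub_le _ _)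
  have h7 : ρ / 8 = r * (h / 4) := by rw [h4]; ring
  rw [h7]
  rcases le_total ‖laplaceShift (pulse β σ ω t) (t + h) 0‖ ‖laplaceShift (pulse β σ ω t) t 0‖
    with h5 | h5
  · exact Or.inl (mul_le_mul_of_nonneg_left (by linarith) hr0)
  · exact Or.inr (mul_le_mul_of_nonneg_left (by linarith) hr0)

variable {U Λ : Set ℂ} {k : ℂ → ℝ}
  {R : ℂ → (ℂ × weightedAnalytic U k →L[ℂ] ℂ × weightedAnalytic U k)}

/-- The pulse at time `M_K(r)` gives rise to an orbit whose norm is bounded independently of `r`. -/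
theorem exists_orbit_pulse (hM : RegularlyGrowing M) (hK : RegularlyGrowing K)
    {β δ₀ r : ℝ} (hβ0 : 0 < β) (hδ₀ : 4 ≤ δ₀) (hδ₀' : β ≤ δ₀ * M 0)
    (hU : U = Omega fun s => δ₀ * M s) (hk : k = imWeight K) (hΛ : Λ ⊆ U)
    (hR1 : ∀ a ∈ Λ, ∀ x, (R a x).1 = evalAt U k a x.2)
    (hR2 : ∀ a ∈ Λ, ∀ x, ∀ w ∈ U, w ≠ a →
      evalAt U k w (R a x).2 = (evalAt U k a x.2 - evalAt U k w x.2) / (w - a))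
    (hr : 1 ≤ r) (hL : 1 ≤ logFactor K r) (hσ8 : 1 / (β * r) ≤ 1 / 8)
    (hlog : Real.log (logFactor K r) ≤ β * r)
    (hgood : ∀ s, 0 ≤ s → s ≤ r → M r * Real.exp (-(β * (r - s))) ≤ M s) :
    ∃ g : mildSolutions Λ R,
      ‖g‖ ≤ 4 * Real.pi * Real.exp 1 * (1 + 1 / K 0) + 2 * (2 / (1 / β)) / K 0 + 2 ∧
      ∀ s : ℝ≥0, ∀ z ∈ U, evalAt U k z ((g : ℝ≥0 →ᵇ ℂ × weightedAnalytic U k) s).2 =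
        laplaceShift (pulse β (1 / (β * r)) (r + Real.log (logFactor K r) / β) (MK M K r)) s z := by
  have hK0 := hK.pos 0 le_rfl
  set C₀ : ℝ := 4 * Real.pi * Real.exp 1 * (1 + 1 / K 0) with hC₀
  have hC₀0 : 0 < C₀ := by have := Real.pi_pos; positivity
  set σ : ℝ := 1 / (β * r) with hσ
  set ω : ℝ := r + Real.log (logFactor K r) / β with hω
  set t : ℝ := MK M K r with ht
  have hσ0 : 0 < σ := by positivity
  obtain ⟨B', hB'⟩ := exists_lipschitz_pulse (ω := ω) (t := t) hβ0 hσ0 (by linarith)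
  have htwo : ∀ z ∈ U, z.re ≤ 0 → ‖twoSided (pulse β σ ω t) z‖ ≤
      C₀ * k z * Real.exp (-(σ * |β * (r - z.im)|)) := fun z hz hz0 => by
    subst hU hk
    exact norm_twoSided_pulse_le hM hK hδ₀ hβ0 hδ₀' hr hL hσ8 hlog hgood hz hz0
  have hkpos : ∀ z, 0 < k z := fun z => by subst hk; exact imWeight_pos hK z
  have hUre : ∀ z ∈ U, -(1 / β) < z.re := fun z hz => by
    subst hU
    have h1 := neg_one_div_lt_re (by linarith) hM hz
    have h2 : 1 / (δ₀ * M 0) ≤ 1 / β := by gcongr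
    linarith
  have htwo1 : ∀ z ∈ U, z.re ≤ 0 → ‖twoSided (pulse β σ ω t) z‖ ≤ C₀ * k z := fun z hz hz0 =>
    (htwo z hz hz0).trans (mul_le_of_le_one_right (mul_pos hC₀0 (hkpos z)).le
      (Real.exp_le_one_iff.2 (neg_nonpos.2 (by positivity))))
  -- The decay e^{-σy} pays for the factor |z|. The constant depends on r, which is harmless: it
  -- affects only uniform continuity of the orbit.
  have htwo2 : ∀ z ∈ U, z.re ≤ 0 → ‖z‖ * ‖twoSided (pulse β σ ω t) z‖ ≤
      C₀ * (1 / β + r + 1 / (β * σ)) * k z := fun z hz hz0 => by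
    have h1 : ‖z‖ ≤ 1 / β + r + |β * (r - z.im)| / β := by
      have h2 := Complex.norm_le_abs_re_add_abs_im z
      have h3 : |z.re| ≤ 1 / β := by
        rw [abs_of_nonpos hz0]
        linarith [hUre z hz]
      have h4 : |z.im| ≤ r + |r - z.im| := by
        have := abs_sub_abs_le_abs_sub z.im r
        rw [abs_of_nonneg (by linarith : 0 ≤ r), abs_sub_comm] at this
        linarith
      have h5 : |β * (r - z.im)| / β = |r - z.im| := by
        rw [abs_mul, abs_of_pos hβ0]
        field_simp
      linarith
    have h2 := htwo z hz hz0
    have h3 : 0 ≤ |β * (r - z.im)| := abs_nonneg _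
    generalize |β * (r - z.im)| = y at h1 h2 h3
    have h4 : Real.exp (-(σ * y)) ≤ 1 := Real.exp_le_one_iff.2 (neg_nonpos.2 (by positivity))
    have h5 : y * Real.exp (-(σ * y)) ≤ 1 / σ := by
      rw [Real.exp_neg, ← div_eq_mul_inv, div_le_div_iff₀ (Real.exp_pos _) hσ0]
      linarith [Real.add_one_le_exp (σ * y)]
    have hkz := hkpos z
    calc ‖z‖ * ‖twoSided (pulse β σ ω t) z‖
        ≤ (1 / β + r + y / β) * (C₀ * k z * Real.exp (-(σ * y))) :=
          mul_le_mul h1 h2 (norm_nonneg _) (by positivity)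
      _ = C₀ * k z * ((1 / β + r) * Real.exp (-(σ * y)) +
          y * Real.exp (-(σ * y)) / β) := by ring
      _ ≤ C₀ * k z * ((1 / β + r) * 1 + 1 / σ / β) := by gcongr
      _ = C₀ * (1 / β + r + 1 / (β * σ)) * k z := by
          rw [mul_comm β σ, ← div_div]
          ring
  exact exists_orbit (B := 2) (κ := 1 / β) (t := t) (k₀ := K 0) (C := C₀)
    (by rw [hU]; exact isOpen_Omega (hM.const_mul (by linarith)))
    (by rw [hk]; exact (continuous_imWeight hK).continuousOn) hK0
    (fun z _ => by rw [hk]; exact hK.mono le_rfl (abs_nonneg _)) hΛ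
    hR1 hR2 (by positivity) hUre (continuous_pulse hσ0) (norm_pulse_le hβ0 hσ0 (by linarith))
    hC₀0.le (by positivity) hB' htwo1 htwo2

/-- The pulses show that `R(0)` has values of order at least `1 / r` at times beyond `M_K(r)`, for
suitable large `r`. -/
theorem exists_lower_bound (hM : RegularlyGrowing M) (hK : RegularlyGrowing K)
    {α δ₀ : ℝ} (hα : 0 < α) (hgrowth : MK M K =O[atTop] fun s : ℝ => Real.exp (α * s))
    (hδ₀ : 4 ≤ δ₀) (hδ₀' : 2 * α ≤ δ₀ * M 0) (hU : U = Omega fun s => δ₀ * M s)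
    (hk : k = imWeight K) (hΛ : Λ ⊆ U)
    (hR1 : ∀ a ∈ Λ, ∀ x, (R a x).1 = evalAt U k a x.2)
    (hR2 : ∀ a ∈ Λ, ∀ x, ∀ w ∈ U, w ≠ a →
      evalAt U k w (R a x).2 = (evalAt U k a x.2 - evalAt U k w x.2) / (w - a))
    (h0 : (0 : ℂ) ∈ Λ) :
    ∃ c G : ℝ, 0 < c ∧ 0 < G ∧ ∀ N : ℝ, ∃ r, N ≤ r ∧ 0 ≤ r ∧ ∃ g : mildSolutions Λ R, ‖g‖ ≤ G ∧
      ∃ s : ℝ≥0, MK M K r ≤ s ∧ c ≤ r * ‖R 0 ((g : ℝ≥0 →ᵇ ℂ × weightedAnalytic U k) s)‖ := by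
  set β : ℝ := 2 * α with hβ
  have hβ0 : 0 < β := by positivity
  have hK0 := hK.pos 0 le_rfl
  obtain ⟨ρ, hρ, hlow⟩ := exists_large_pulse hM hK hβ0 (show α < β by linarith)
    (show 2 * α ≤ β from le_rfl) hα hgrowth
  refine ⟨ρ / 8, 4 * Real.pi * Real.exp 1 * (1 + 1 / K 0) + 2 * (2 / (1 / β)) / K 0 + 2,
    by positivity, by have := Real.pi_pos; positivity, fun N => ?_⟩
  obtain ⟨r, hN, hr, hL, hσ8, hlog, hgood, h, hh, hint⟩ := hlow N
  have hr0 : 0 ≤ r := by linarith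
  obtain ⟨g, hgn, hg⟩ := exists_orbit_pulse hM hK hβ0 hδ₀ hδ₀' hU hk hΛ hR1 hR2 hr hL hσ8 hlog hgood
  refine ⟨r, hN, hr0, g, hgn, ?_⟩
  have ht0 : 0 ≤ MK M K r := mul_nonneg (hM.pos r hr0).le (logFactor_pos hK hr0).le
  set u := laplaceShift (pulse β (1 / (β * r)) (r + Real.log (logFactor K r) / β) (MK M K r))
    with hu
  have hval : ∀ s : ℝ, 0 ≤ s → ‖u s 0‖ ≤
      ‖R 0 ((g : ℝ≥0 →ᵇ ℂ × weightedAnalytic U k) s.toNNReal)‖ := fun s hs => by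
    have h1 := hg s.toNNReal 0 (hΛ h0)
    rw [Real.coe_toNNReal _ hs, ← hR1 0 h0] at h1
    rw [← h1]
    exact norm_fst_le _
  rcases hint with h1 | h1
  · exact ⟨(MK M K r).toNNReal, Real.le_coe_toNNReal _,
      h1.trans (mul_le_mul_of_nonneg_left (hval _ ht0) hr0)⟩
  · refine ⟨(MK M K r + h).toNNReal, ?_,
      h1.trans (mul_le_mul_of_nonneg_left (hval _ (by linarith)) hr0)⟩
    rw [Real.coe_toNNReal _ (by linarith)]
    linarith

end Construction

/-! ### Positivity of the upper limit, and assembly -/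

theorem MKinv_MK {M K : ℝ → ℝ} (hM : RegularlyGrowing M) (hK : RegularlyGrowing K) {r : ℝ}
    (hr : 0 ≤ r) : MKinv M K (MK M K r) = r :=
  (bijOn_MK hM hK).injOn.leftInvOn_invFunOn hr

theorem tendsto_MK {M K : ℝ → ℝ} (hM : RegularlyGrowing M) (hK : RegularlyGrowing K) :
    Tendsto (MK M K) atTop atTop := by
  have h1 : Tendsto (fun s : ℝ => M 0 * Real.log (1 + s)) atTop atTop :=
    (Real.tendsto_log_atTop.comp (tendsto_atTop_add_const_left _ 1 tendsto_id)).const_mul_atTop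
      (hM.pos 0 le_rfl)
  refine tendsto_atTop_mono' _ ?_ h1
  filter_upwards [eventually_ge_atTop (0 : ℝ)] with s hs
  exact mul_le_mul (hM.mono le_rfl hs) (log_le_logFactor hK hs)
    (Real.log_nonneg (by linarith)) (hM.pos s hs).le

theorem enorm_ofReal_smul {X : Type*} [NormedAddCommGroup X] [NormedSpace ℂ X] (B : X →L[ℂ] X)
    {r : ℝ} (hr : 0 ≤ r) : ‖(r : ℂ) • B‖ₑ = ENNReal.ofReal (r * ‖B‖) := by
  rw [← ofReal_norm, norm_smul, Complex.norm_real, Real.norm_of_nonneg hr]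

/-- A lower bound for `R(0)` on orbits at times beyond `M_K(r)` bounds `‖T(t) A⁻¹‖` from below. -/
theorem limsup_norm_translation_inverse_pos {H : Type*} [NormedAddCommGroup H] [NormedSpace ℂ H]
    [CompleteSpace H] {Λ : Set ℂ} {R : ℂ → H →L[ℂ] H} {M K : ℝ → ℝ} (hM : RegularlyGrowing M)
    (hK : RegularlyGrowing K) (h0 : (0 : ℂ) ∈ Λ) (hR : ∀ w ∈ Λ, ∀ x, R 0 (R w x) = R w (R 0 x))
    (hlow : ∃ c G : ℝ, 0 < c ∧ 0 < G ∧ ∀ N : ℝ, ∃ r, N ≤ r ∧ 0 ≤ r ∧ ∃ g : mildSolutions Λ R,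
      ‖g‖ ≤ G ∧ ∃ s : ℝ≥0, MK M K r ≤ s ∧ c ≤ r * ‖R 0 ((g : ℝ≥0 →ᵇ H) s)‖) :
    0 < limsup (fun t : ℝ => ‖((MKinv M K t : ℝ) : ℂ) •
      (translation Λ R t).comp (inverse (generator (translation Λ R)))‖ₑ) atTop := by
  obtain ⟨c, G, hc, hG, hlow⟩ := hlow
  rw [(isBoundedInverse_pointwise h0 hR).neg_of_shift_zero.inverse_eq]
  refine (ENNReal.ofReal_pos.2 (div_pos hc hG)).trans_le (le_limsup_of_frequently_le ?_)
  -- The upper limit is tested along the times t = M_K(r), where the inverse of M_K returns r.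
  refine (tendsto_MK hM hK).frequently ((frequently_atTop.2 hlow).mono fun r hr => ?_)
  obtain ⟨hr0, g, hg, s, hs, hcs⟩ := hr
  rw [MKinv_MK hM hK hr0, enorm_ofReal_smul _ hr0]
  refine ENNReal.ofReal_le_ofReal ?_
  set B := (translation Λ R (MK M K r)).comp (-pointwise (R 0) hR) with hB
  obtain ⟨q, rfl⟩ : ∃ q : ℝ≥0, s = q + (MK M K r).toNNReal :=
    -- The orbit is large at some s ≥ M_K(r), not necessarily at M_K(r) itself; the supremum norm of
    -- the translate sees all later times.
    ⟨s - _, (tsub_add_cancel_of_le (Real.toNNReal_le_iff_le_coe.2 hs)).symm⟩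
  have h1 : ‖R 0 ((g : ℝ≥0 →ᵇ H) (q + (MK M K r).toNNReal))‖ ≤ ‖B g‖ := by
    rw [← norm_neg]
    exact mildSolutions_norm_apply_le (B g) q
  rw [div_le_iff₀ hG]
  calc c ≤ r * ‖R 0 ((g : ℝ≥0 →ᵇ H) (q + (MK M K r).toNNReal))‖ := hcs
    _ ≤ r * (‖B‖ * G) := by
        gcongr
        exact h1.trans ((B.le_opNorm g).trans (by gcongr))
    _ = r * ‖B‖ * G := by ring

/-- The generator of the translation semigroup satisfies the required resolvent bound. -/
theorem exists_resolvent_bound {H : Type*} [NormedAddCommGroup H] [NormedSpace ℂ H]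
    [CompleteSpace H] {Λ : Set ℂ} {R : ℂ → H →L[ℂ] H} {k : ℂ → ℝ} {C : ℝ}
    (hR : ∀ z ∈ Λ, ∀ w ∈ Λ, ∀ x, R z (R w x) = R w (R z x)) (hk : ∀ z, 0 < k z)
    (hRk : ∀ z ∈ Λ, ‖R z‖ ≤ C * k z) :
    Λ ⊆ resolventSet (generator (translation Λ R)) ∧ ∃ C : ℝ, ∀ z ∈ Λ,
      ‖SemigroupDecay.resolvent (generator (translation Λ R)) z‖ / k z ≤ C := by
  refine ⟨fun z hz => ⟨_, isBoundedInverse_pointwise hz (hR z hz)⟩, C, fun z hz => ?_⟩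
  rw [SemigroupDecay.resolvent, (isBoundedInverse_pointwise hz (hR z hz)).inverse_eq,
    div_le_iff₀ (hk z)]
  exact (norm_pointwise_le _ _).trans (hRk z hz)

end SemigroupDecay

open SemigroupDecay in
theorem theorem3p1 (M K : ℝ → ℝ)
    (hM : SemigroupDecay.RegularlyGrowing M) (hK : SemigroupDecay.RegularlyGrowing K)
    (hMK : ∀ s : ℝ, 0 ≤ s → M s ≤ K s)
    (α : ℝ) (hα : 0 < α)
    (hgrowth : SemigroupDecay.MK M K =O[atTop] fun s : ℝ => Real.exp (α * s)) :
    ∃ (X : Type) (_ : NormedAddCommGroup X) (_ : NormedSpace ℂ X) (_ : CompleteSpace X)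
      (T : ℝ → X →L[ℂ] X),
      SemigroupDecay.IsC0Semigroup T ∧ SemigroupDecay.IsBoundedSemigroup T ∧
      (∃ δ : ℝ, 1 < δ ∧
        SemigroupDecay.Omega (fun s => δ * M s) ⊆
          SemigroupDecay.resolventSet (SemigroupDecay.generator T) ∧
        ∃ C : ℝ, ∀ z ∈ SemigroupDecay.Omega (fun s => δ * M s),
          ‖SemigroupDecay.resolvent (SemigroupDecay.generator T) z‖ / K |z.im| ≤ C) ∧
      0 < limsup (fun t : ℝ =>
        ‖((SemigroupDecay.MKinv M K t : ℝ) : ℂ) •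
          (T t).comp (SemigroupDecay.inverse (SemigroupDecay.generator T))‖ₑ) atTop := by
  have hM0 := hM.pos 0 le_rfl
  -- The bound 4 lets the pulse absorb e^{-zt}; the bound 2α/M(0) puts the region where Re z > -1/β,
  -- for β = 2α.
  set δ₀ : ℝ := max 4 (2 * α / M 0) with hδ₀
  have hδ₀4 : 4 ≤ δ₀ := le_max_left _ _
  have hδ₀α : 2 * α ≤ δ₀ * M 0 := (div_le_iff₀ hM0).1 (le_max_right _ _)
  obtain ⟨δ, C, hδ, hC, hD⟩ := exists_norm_dslope_le hM hK hMK (by linarith : 1 ≤ δ₀)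
  set U := Omega fun s => δ₀ * M s with hU
  set Λ := Omega fun s => δ * M s with hΛdef
  set k := imWeight K with hk
  have hUo : IsOpen U := isOpen_Omega (hM.const_mul (by linarith))
  have hkc : ContinuousOn k U := (continuous_imWeight hK).continuousOn
  have hk0 : ∀ z ∈ U, 0 < k z := fun z _ => imWeight_pos hK z
  have hΛ : Λ ⊆ U := Omega_subset_Omega hM (by linarith) hδ.le
  obtain ⟨R, hR⟩ := exists_resolvents hUo hkc hk0 hΛ hC hD
  have hR1 := fun a ha => (hR a ha).2.1
  have hR2 := fun a ha => (hR a ha).2.2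
  have hcomm : ∀ a ∈ Λ, ∀ w ∈ Λ, ∀ x, R a (R w x) = R w (R a x) := fun a ha w hw x =>
    resolvents_commute hUo hk0 hΛ hR1 hR2 ha hw x
  have hcomplete : CompleteSpace (weightedAnalytic U k) :=
    (isClosed_weightedAnalytic hUo hkc).completeSpace_coe
  have h0 : (0 : ℂ) ∈ Λ := zero_mem_Omega hM (by linarith)
  exact ⟨mildSolutions Λ R, inferInstance, inferInstance, inferInstance, translation Λ R,
    isC0Semigroup_translation, isBoundedSemigroup_translation,
    ⟨δ, by linarith, exists_resolvent_bound hcomm (imWeight_pos hK) fun z hz => (hR z hz).1⟩,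
    limsup_norm_translation_inverse_pos hM hK h0 (hcomm 0 h0)
      (exists_lower_bound hM hK hα hgrowth hδ₀4 hδ₀α hU hk hΛ hR1 hR2 h0)⟩

end
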